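/- Let $k\ge 1$ be an integer and let $d_k(n)$ be the number of ordered $k$-tuples of positive integers with product $n$. For $\rho,x>0$ put $$\Psi_{\rho,k}(x)=\frac{\pi^{k/2-1}}{2^{k-1}}\sum_{j=1}^{\infty}d_k(j)\,G_{0,2k}^{k+1,0}\!\left(\begin{matrix}-\\(0)_k,\tfrac12;(\tfrac12)_{k-1}\end{matrix}\ \Big|\ \frac{\rho^2j^2x^2}{2^{2k}}\right),$$ where $(a)_r$ means that the parameter $a$ is repeated $r$ times, and the Meijer $G$-function is, for $z>0$ and any real $C<0$, $$G_{0,2k}^{k+1,0}\!\left(\begin{matrix}-\\(0)_k,\tfrac12;(\tfrac12)_{k-1}\end{matrix}\ \Big|\ z\right)=\frac1{2\pi i}\int_{C-i\infty}^{C+i\infty}\frac{\Gamma(-s)^k\,\Gamma(\tfrac12-s)}{\Gamma(\tfrac12+s)^{k-1}}\,z^s\,ds .$$ These integrals and the series defining $\Psi_{\rho,k}(x)$ converge absolutely. Let $\alpha,\beta>0$ be real numbers with $\alpha\beta=\pi^2$. Then the two series on the left below converge absolutely, and, for every choice of $C<0$ in the definition of $\Psi$, $$\alpha^k\sum_{n=1}^{\infty}n\,d_k(n)\Psi_{(2\alpha)^k,k}(n)+\beta^k\sum_{n=1}^{\infty}n\,d_k(n)\Psi_{(2\beta)^k,k}(n)$$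 $$=\frac1{(k-1)!}\,\frac{d^{k-1}}{ds^{k-1}}\left\{\zeta^k(s-1)\,\zeta^k(s)\,\Gamma^k(s+1)\cos^{k-1}\!\left(\frac{\pi s}2\right)2^{-ks}\left(\alpha^{-k(s-1)}+\beta^{-k(s-1)}\right)\right\}\Bigg|_{s=0}-\left(\frac{\pi}{2}\right)^{k-1}2^{-2k}.$$ -/

import Mathlib

namespace ZetaPower

noncomputable section

/-- The Piltz divisor function `d_k(n)`: the number of ordered `k`-tuples of positive integers
with product `n`. -/
def piltz (k n : ℕ) : ℕ := (Nat.finMulAntidiag k n).card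

/-- The Mellin–Barnes integrand of the Meijer `G`-function. With `m`, `n` the lengths of `b₁`, `a₁`,
the list `b₁` holds the lower parameters `b_1, …, b_m` and `b₂` the remaining ones
`b_{m+1}, …, b_q`; `a₁` holds the upper parameters `a_1, …, a_n` and `a₂` the remaining ones
`a_{n+1}, …, a_p`. -/
def meijerIntegrand (a₁ a₂ b₁ b₂ : List ℂ) (z s : ℂ) : ℂ :=
  (b₁.map fun b => Complex.Gamma (b - s)).prod * (a₁.map fun a => Complex.Gamma (1 - a + s)).prod /
    ((b₂.map fun b => Complex.Gamma (1 - b + s)).prod *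
      (a₂.map fun a => Complex.Gamma (a - s)).prod) * z ^ s

/-- The Meijer `G`-function as the integral `1 / (2πi) ∫_{(C)} … ds` over the vertical line
`Re s = C`, parametrized by `s = C + i t` (so `ds = i dt`). The line has to separate the poles of
`Γ(b_j - s)` (on its right) from those of `Γ(1 - a_j + s)` (on its left). -/
def meijerG (C : ℝ) (a₁ a₂ b₁ b₂ : List ℂ) (z : ℂ) : ℂ :=
  1 / (2 * Real.pi) * ∫ t : ℝ, meijerIntegrand a₁ a₂ b₁ b₂ z (C + t * Complex.I)

/-- The first `k + 1` lower parameters `(0)_k, 1/2` of the `G`-function defining `Ψ_{ρ,k}`. -/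
def lowerFst (k : ℕ) : List ℂ := List.replicate k 0 ++ [1 / 2]

/-- The last `k - 1` lower parameters `(1/2)_{k-1}` of the `G`-function defining `Ψ_{ρ,k}`. -/
def lowerSnd (k : ℕ) : List ℂ := List.replicate (k - 1) (1 / 2)

/-- The argument `ρ² j² x² / 2^{2k}` of the `G`-function in the `j`-th term of `Ψ_{ρ,k}(x)`. -/
def psiArg (k : ℕ) (ρ x : ℝ) (j : ℕ) : ℝ := ρ ^ 2 * (j : ℝ) ^ 2 * x ^ 2 / 2 ^ (2 * k)

/-- The `j`-th term `d_k(j) G^{k+1,0}_{0,2k}((0)_k, 1/2; (1/2)_{k-1} | ρ² j² x² / 2^{2k})` of the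
series defining `Ψ_{ρ,k}(x)`. All poles of the integrand lie in `Re s ≥ 0`, so the admissible
lines are those with `C < 0`. -/
def psiTerm (C : ℝ) (k : ℕ) (ρ x : ℝ) (j : ℕ) : ℂ :=
  (piltz k j : ℂ) * meijerG C [] [] (lowerFst k) (lowerSnd k) (psiArg k ρ x j)

/-- `Ψ_{ρ,k}(x) = π^{k/2-1} / 2^{k-1} ∑_{j ≥ 1} d_k(j) G^{k+1,0}_{0,2k}(…)`, with all
`G`-functions taken along the line `Re s = C`. -/
def Psi (C : ℝ) (k : ℕ) (ρ x : ℝ) : ℂ :=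
  ((Real.pi ^ ((k : ℝ) / 2 - 1) / 2 ^ (k - 1) : ℝ) : ℂ) * ∑' j : ℕ+, psiTerm C k ρ x j

end

end ZetaPower

namespace ZetaPower

open Complex MeasureTheory Set Filter Topology

/-! ### Exponential decay of the Gamma function on vertical lines -/

/-! Write `k = m + 1`. Under `w = -2s`, reflection and duplication turn the Meijer integrand into a
constant times `Γ(w)^k cos(πw/2)^(k-1) y^(-w)` (`meijerIntegrand_eq`), and the prefactor of `Ψ`
cancels that constant. Summing over `j` produces `ζ(w)^k` (`Psi_eq`); summing over `n` with weight
`n d_k(n)` produces `ζ(w-1)^k` (`hasSum_mul_piltz_mul_Psi`). So the left side is `1/(2πi)` times the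
integral of `F = symIntegrand` over `Re w = 5/2` (`series_add_series`).

The functional equation of `ζ` rewrites `F` as `(ζ(1-w) ζ(w-1) π^w / 2)^k / cos(πw/2)` times
`powSum`. Under `w ↦ 2 - w` the zeta product is invariant, the cosine changes sign, and `αβ = π²`
makes `π^(kw) powSum` invariant; hence `F(2-w) = -F(w)` (`symIntegrand_two_sub`).

Let `J_c` be the integral of `F` over `Re w = c`, taken in `t = Im w`. Oddness gives `J_{5/2} =
-J_{-1/2}` and `J_{3/2} = -J_{1/2}`. Crossing the poles at 0 and 1, with residues `R₀` and `R₁`,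
gives `J_{1/2} - J_{-1/2} = 2πR₀` and `J_{3/2} - J_{1/2} = 2πR₁`. Therefore `J_{5/2}/(2π) = R₀ +
R₁/2`, and the pole at 2 is never crossed. `R₀` comes from a pole of order at most `k` and is the
derivative term; `R₁/2` is the constant term.

The analytic input is growth in vertical strips: `Γ^k cos^(k-1)` decays almost like `exp(-π|Im
w|/2)` and `ζ` grows subexponentially, so every sum, integral and shift is legitimate. -/

lemma norm_gammaKernel {s r : ℂ} {t : ℝ} (ht : 0 < t) :
    ‖(t : ℂ) ^ s * cexp (-(r * t))‖ = t ^ s.re * Real.exp (-(r.re * t)) := by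
  rw [norm_mul, norm_cpow_eq_rpow_re_of_pos ht, norm_exp]
  simp

lemma integrableOn_rpow_mul_exp_neg_mul {a r : ℝ} (ha : -1 < a) (hr : 0 < r) :
    IntegrableOn (fun t : ℝ => t ^ a * Real.exp (-(r * t))) (Ioi 0) := by
  simpa using integrableOn_rpow_mul_exp_neg_mul_rpow ha one_pos hr

lemma aestronglyMeasurable_gammaKernel (s r : ℂ) :
    AEStronglyMeasurable (fun t : ℝ => (t : ℂ) ^ s * cexp (-(r * t)))
      (volume.restrict (Ioi 0)) := by
  refine ContinuousOn.aestronglyMeasurable (fun t ht => ?_) measurableSet_Ioi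
  have h : (t : ℂ) ∈ slitPlane := Or.inl (by simpa using ht)
  refine ContinuousAt.continuousWithinAt ?_
  exact (continuousAt_ofReal_cpow_const _ _ (Or.inr (ne_of_gt ht))).mul (by fun_prop)

lemma integrableOn_gammaKernel {s r : ℂ} (hs : -1 < s.re) (hr : 0 < r.re) :
    IntegrableOn (fun t : ℝ => (t : ℂ) ^ s * cexp (-(r * t))) (Ioi 0) := by
  refine (integrableOn_rpow_mul_exp_neg_mul hs hr).mono'
    (aestronglyMeasurable_gammaKernel s r) ?_
  filter_upwards [ae_restrict_mem measurableSet_Ioi] with t ht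
  exact (norm_gammaKernel ht).le

lemma differentiableAt_integral_gammaKernel {s r : ℂ} (hs : 0 < s.re) (hr : 0 < r.re) :
    DifferentiableAt ℂ (fun r : ℂ => ∫ t : ℝ in Ioi 0, (t : ℂ) ^ (s - 1) * cexp (-(r * t))) r := by
  have hnhds : {z : ℂ | r.re / 2 < z.re} ∈ 𝓝 r :=
    (isOpen_lt continuous_const continuous_re).mem_nhds (by simp; linarith)
  refine (hasDerivAt_integral_of_dominated_loc_of_deriv_le
    (F' := fun r t => -((t : ℂ) ^ s * cexp (-(r * t))))
    (bound := fun t => t ^ s.re * Real.exp (-(r.re / 2 * t))) hnhds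
    (Eventually.of_forall fun z => aestronglyMeasurable_gammaKernel _ z)
    (integrableOn_gammaKernel (by simpa using hs) hr)
    (aestronglyMeasurable_gammaKernel s r).neg ?_
    (integrableOn_rpow_mul_exp_neg_mul (by linarith) (by linarith)) ?_).2.differentiableAt
  · filter_upwards [ae_restrict_mem measurableSet_Ioi] with t ht z hz
    have ht' : (0 : ℝ) < t := ht
    have hz' : r.re / 2 < z.re := hz
    rw [norm_neg, norm_gammaKernel ht]
    gcongr
  · filter_upwards [ae_restrict_mem measurableSet_Ioi] with t ht z hz
    have ht' : (t : ℂ) ≠ 0 := by exact_mod_cast (ne_of_gt ht)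
    have h1 : HasDerivAt (fun z : ℂ => cexp (-(z * t))) (cexp (-(z * t)) * (-(1 * (t : ℂ)))) z :=
      (((hasDerivAt_id z).mul_const (t : ℂ)).neg).cexp
    convert! h1.const_mul ((t : ℂ) ^ (s - 1)) using 1
    rw [show s = (s - 1) + 1 by ring, cpow_add _ _ ht', cpow_one]
    ring_nf

/-- The Gamma integral along a rotated ray. -/
theorem integral_cpow_mul_exp_neg_mul_of_re_pos {s r : ℂ} (hs : 0 < s.re) (hr : 0 < r.re) :
    ∫ t : ℝ in Ioi 0, (t : ℂ) ^ (s - 1) * cexp (-(r * t)) = r ^ (-s) * Gamma s := by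
  have hopen : IsOpen {z : ℂ | 0 < z.re} := isOpen_lt continuous_const continuous_re
  have hconv : Convex ℝ {z : ℂ | 0 < z.re} := convex_halfSpace_re_gt 0
  have hf : AnalyticOnNhd ℂ
      (fun r : ℂ => ∫ t : ℝ in Ioi 0, (t : ℂ) ^ (s - 1) * cexp (-(r * t))) {z : ℂ | 0 < z.re} :=
    DifferentiableOn.analyticOnNhd
      (fun z hz => (differentiableAt_integral_gammaKernel hs hz).differentiableWithinAt) hopen
  have hg : AnalyticOnNhd ℂ (fun r : ℂ => r ^ (-s) * Gamma s) {z : ℂ | 0 < z.re} := by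
    refine DifferentiableOn.analyticOnNhd (fun z hz => ?_) hopen
    have : z ∈ slitPlane := Or.inl hz
    exact ((differentiableAt_id.cpow_const this).mul_const _).differentiableWithinAt
  -- Identity theorem in `r`: both sides are analytic on the right half-plane and agree for real `r
  -- > 0`, which accumulate at 1.
  refine hf.eqOn_of_preconnected_of_frequently_eq hg hconv.isPreconnected
    (z₀ := 1) (by simp) ?_ hr
  have hlim : Tendsto (fun x : ℝ => (x : ℂ)) (𝓝[≠] 1) (𝓝[≠] 1) := by
    refine tendsto_nhdsWithin_iff.2 ⟨?_, ?_⟩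
    · simpa using (continuous_ofReal.tendsto (1 : ℝ)).mono_left nhdsWithin_le_nhds
    · filter_upwards [self_mem_nhdsWithin] with x hx
      simpa using hx
  refine hlim.frequently (Eventually.frequently ?_)
  filter_upwards [nhdsWithin_le_nhds (lt_mem_nhds (zero_lt_one' ℝ))] with x hx
  rw [integral_cpow_mul_exp_neg_mul_Ioi hs hx, one_div,
    inv_cpow _ _ (by rw [arg_ofReal_of_nonneg hx.le]; exact Real.pi_pos.ne), cpow_neg]

/-- Decay of `Γ` along vertical lines, with any rate below `π / 2`. -/
theorem norm_Gamma_le_of_abs_lt {s : ℂ} (hs : 0 < s.re) {θ : ℝ} (hθ : |θ| < Real.pi / 2) :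
    ‖Gamma s‖ ≤ (1 / Real.cos θ) ^ s.re * Real.Gamma s.re * Real.exp (-(θ * s.im)) := by
  have hθ' := abs_lt.1 hθ
  have hcos : 0 < Real.cos θ := Real.cos_pos_of_mem_Ioo hθ'
  -- Take `r = e^{iθ}`: the factor `r^(-s)` has modulus `exp(θ Im s)`, while the integral is
  -- dominated by a real Gamma integral with rate `cos θ`.
  set r : ℂ := Real.cos θ + Real.sin θ * I with hr
  have hre : r.re = Real.cos θ := by simp [hr, -ofReal_cos, -ofReal_sin]
  have hrpos : 0 < r.re := hre ▸ hcos
  have hnorm : ‖r ^ (-s)‖ = Real.exp (θ * s.im) := by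
    have hr1 : ‖r‖ = 1 := by rw [hr, ofReal_cos, ofReal_sin]; exact norm_cos_add_sin_mul_I θ
    have harg : arg r = θ := by
      rw [hr, ofReal_cos, ofReal_sin]
      exact arg_cos_add_sin_mul_I ⟨by linarith [hθ'.1, Real.pi_pos], by linarith [hθ'.2, Real.pi_pos]⟩
    rw [norm_cpow_of_ne_zero (by rintro h; simp [h] at hrpos), hr1, harg]
    simp [← Real.exp_neg]
  have key := integral_cpow_mul_exp_neg_mul_of_re_pos hs hrpos
  have hle : ‖r ^ (-s) * Gamma s‖ ≤ (1 / Real.cos θ) ^ s.re * Real.Gamma s.re := by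
    rw [← key, ← Real.integral_rpow_mul_exp_neg_mul_Ioi hs hcos]
    refine (norm_integral_le_integral_norm _).trans (le_of_eq ?_)
    refine setIntegral_congr_fun measurableSet_Ioi fun t ht => ?_
    simp only [norm_gammaKernel (s := s - 1) (r := r) ht, hre]
    simp
  rw [norm_mul, hnorm] at hle
  rw [Real.exp_neg, ← div_eq_mul_inv, le_div_iff₀ (Real.exp_pos _), mul_comm]
  exact hle

/-! ### Exponential growth rates in vertical strips -/

/-- `f` is `O(exp (δ |Im s|))` in the strip `a ≤ Re s ≤ b`, away from the real axis. -/
def StripBound (f : ℂ → ℂ) (a b δ : ℝ) : Prop :=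
  ∃ K : ℝ, 0 ≤ K ∧ ∀ s : ℂ, a ≤ s.re → s.re ≤ b → 1 ≤ |s.im| → ‖f s‖ ≤ K * Real.exp (δ * |s.im|)

namespace StripBound

variable {f g : ℂ → ℂ} {a b δ ε : ℝ}

lemma mono (h : StripBound f a b δ) {a' b' δ' : ℝ} (ha : a ≤ a') (hb : b' ≤ b) (hδ : δ ≤ δ') :
    StripBound f a' b' δ' := by
  obtain ⟨K, hK, h⟩ := h
  refine ⟨K, hK, fun s h1 h2 h3 => (h s (ha.trans h1) (h2.trans hb) h3).trans ?_⟩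
  gcongr

lemma congr (h : StripBound f a b δ)
    (hfg : ∀ s : ℂ, a ≤ s.re → s.re ≤ b → s.im ≠ 0 → g s = f s) : StripBound g a b δ := by
  obtain ⟨K, hK, h⟩ := h
  refine ⟨K, hK, fun s h1 h2 h3 => ?_⟩
  rw [hfg s h1 h2 (by rintro h0; norm_num [h0] at h3)]
  exact h s h1 h2 h3

lemma mul (hf : StripBound f a b δ) (hg : StripBound g a b ε) :
    StripBound (fun s => f s * g s) a b (δ + ε) := by
  obtain ⟨K, hK, hf⟩ := hf
  obtain ⟨L, hL, hg⟩ := hg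
  refine ⟨K * L, mul_nonneg hK hL, fun s h1 h2 h3 => ?_⟩
  rw [norm_mul, add_mul, Real.exp_add]
  calc _ ≤ (K * Real.exp (δ * |s.im|)) * (L * Real.exp (ε * |s.im|)) :=
        mul_le_mul (hf s h1 h2 h3) (hg s h1 h2 h3) (norm_nonneg _) (by positivity)
    _ = _ := by ring

lemma const (c : ℂ) : StripBound (fun _ => c) a b 0 :=
  ⟨‖c‖, norm_nonneg _, fun s _ _ _ => by simp⟩

lemma pow (hf : StripBound f a b δ) (n : ℕ) : StripBound (fun s => f s ^ n) a b (n * δ) := by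
  induction n with
  | zero => simpa using const 1
  | succ n ih =>
    have := ih.mul hf
    simp only [← pow_succ] at this
    convert! this using 1
    push_cast
    ring

lemma comp_add_const (hf : StripBound f a b δ) (c : ℝ) :
    StripBound (fun s => f (s + c)) (a - c) (b - c) δ := by
  obtain ⟨K, hK, hf⟩ := hf
  refine ⟨K, hK, fun s h1 h2 h3 => ?_⟩
  simpa using hf (s + c) (by simp; linarith) (by simp; linarith) (by simpa using h3)

lemma comp_const_sub (hf : StripBound f a b δ) (c : ℝ) :
    StripBound (fun s => f (c - s)) (c - b) (c - a) δ := by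
  obtain ⟨K, hK, hf⟩ := hf
  refine ⟨K, hK, fun s h1 h2 h3 => ?_⟩
  simpa using hf (c - s) (by simp; linarith) (by simp; linarith) (by simpa using h3)

lemma union {m : ℝ} (h₁ : StripBound f a m δ) (h₂ : StripBound f m b δ) : StripBound f a b δ := by
  obtain ⟨K, hK, h₁⟩ := h₁
  obtain ⟨L, hL, h₂⟩ := h₂
  refine ⟨K + L, add_nonneg hK hL, fun s h1 h2 h3 => ?_⟩
  rw [add_mul]
  rcases le_total s.re m with h | h
  · exact (h₁ s h1 h h3).trans (le_add_of_nonneg_right (by positivity))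
  · exact (h₂ s h h2 h3).trans (le_add_of_nonneg_left (by positivity))

lemma tendsto_zero (hf : StripBound f a b δ) (hδ : δ < 0) :
    ∀ η > 0, ∃ T₀ : ℝ, ∀ s : ℂ, a ≤ s.re → s.re ≤ b → T₀ ≤ |s.im| → ‖f s‖ ≤ η := by
  intro η hη
  obtain ⟨K, hK, hf⟩ := hf
  have hlim : Tendsto (fun t : ℝ => K * Real.exp (δ * t)) atTop (𝓝 0) := by
    simpa using (Real.tendsto_exp_atBot.comp
      (tendsto_id.const_mul_atTop_of_neg hδ)).const_mul K
  obtain ⟨T, hT⟩ := eventually_atTop.1 (hlim.eventually (gt_mem_nhds hη))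
  exact ⟨max T 1, fun s h1 h2 h3 => (hf s h1 h2 (le_trans (le_max_right _ _) h3)).trans
    (hT _ (le_trans (le_max_left _ _) h3)).le⟩

lemma integrable (hf : StripBound f a b δ) (hδ : δ < 0) {c : ℝ} (hac : a ≤ c) (hcb : c ≤ b)
    (hcont : Continuous fun t : ℝ => f (c + t * I)) :
    Integrable fun t : ℝ => f (c + t * I) := by
  obtain ⟨K, hK, hf⟩ := hf
  have hloc : LocallyIntegrable (fun t : ℝ => f (c + t * I)) := hcont.locallyIntegrable
  have hbig : ∀ t : ℝ, 1 ≤ |t| → ‖f (c + t * I)‖ ≤ K * Real.exp (δ * |t|) := by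
    intro t ht
    simpa using hf (c + t * I) (by simpa using hac) (by simpa using hcb) (by simpa using ht)
  have hexp : IntegrableAtFilter (fun t : ℝ => Real.exp (δ * t)) atTop := by
    refine ⟨Ioi 0, Ioi_mem_atTop 0, ?_⟩
    exact integrableOn_exp_mul_Ioi hδ 0
  have hexp' : IntegrableAtFilter (fun t : ℝ => Real.exp (-δ * t)) atBot := by
    refine ⟨Iic 0, Iic_mem_atBot 0, ?_⟩
    exact integrableOn_exp_mul_Iic (by linarith) 0
  refine hloc.integrable_of_isBigO_atBot_atTop (g := fun t : ℝ => Real.exp (-δ * t))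
    (g' := fun t : ℝ => Real.exp (δ * t)) ?_ hexp' ?_ hexp
  · refine Asymptotics.IsBigO.of_bound K ?_
    filter_upwards [eventually_le_atBot (-1 : ℝ)] with t ht
    have h := hbig t (by rw [abs_of_neg (by linarith)]; linarith)
    rw [abs_of_neg (by linarith)] at h
    simpa using h
  · refine Asymptotics.IsBigO.of_bound K ?_
    filter_upwards [eventually_ge_atTop (1 : ℝ)] with t ht
    have h := hbig t (by rw [abs_of_pos (by linarith)]; linarith)
    rw [abs_of_pos (by linarith)] at h
    simpa using h

end StripBound

lemma stripBound_cos (a b : ℝ) : StripBound (fun s => cos (Real.pi * s / 2)) a b (Real.pi / 2) := by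
  refine ⟨1, zero_le_one, fun s _ _ _ => ?_⟩
  have him : ∀ z : ℂ, ‖cos z‖ ≤ Real.exp |z.im| := by
    intro z
    rw [cos, norm_div, Complex.norm_ofNat, div_le_iff₀ two_pos]
    refine (norm_add_le _ _).trans ?_
    rw [norm_exp, norm_exp, mul_two]
    refine add_le_add (Real.exp_le_exp.2 ?_) (Real.exp_le_exp.2 ?_)
    · simpa using neg_le_abs z.im
    · simpa using le_abs_self z.im
  refine (him _).trans (le_of_eq ?_)
  have : (Real.pi * s / 2 : ℂ).im = Real.pi / 2 * s.im := by
    rw [show (Real.pi * s / 2 : ℂ) = ((Real.pi / 2 : ℝ) : ℂ) * s by push_cast; ring, im_ofReal_mul]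
  rw [this, abs_mul, abs_of_pos (by positivity), one_mul]

lemma stripBound_cpow {x : ℝ} (hx : 0 < x) (c : ℝ) (d : ℂ) (a b : ℝ) :
    StripBound (fun s => (x : ℂ) ^ (c * s + d)) a b 0 := by
  obtain ⟨M, hM⟩ := (isCompact_Icc (a := a) (b := b)).exists_bound_of_continuousOn
    (f := fun σ : ℝ => x ^ (c * σ + d.re))
    (Continuous.continuousOn (by
      exact continuous_const.rpow (by fun_prop) (fun _ => Or.inl hx.ne')))
  refine ⟨max M 0, le_max_right _ _, fun s h1 h2 _ => ?_⟩
  rw [norm_cpow_eq_rpow_re_of_pos hx, zero_mul, Real.exp_zero, mul_one]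
  have := hM s.re ⟨h1, h2⟩
  rw [Real.norm_of_nonneg (Real.rpow_nonneg hx.le _)] at this
  simpa using this.trans (le_max_left M 0)

lemma stripBound_Gamma_of_pos {a b ε : ℝ} (ha : 0 < a) (hε : 0 < ε) :
    StripBound Gamma a b (-(Real.pi / 2) + ε) := by
  wlog hε' : ε < Real.pi / 2 generalizing ε
  · exact (this (ε := Real.pi / 4) (by positivity) (by linarith [Real.pi_pos])).mono le_rfl le_rfl
      (by linarith [Real.pi_pos])
  set θ := Real.pi / 2 - ε with hθ
  have hcos : 0 < Real.cos θ :=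
    Real.cos_pos_of_mem_Ioo ⟨by linarith [Real.pi_pos], by linarith⟩
  have hbase : 1 ≤ 1 / Real.cos θ := (one_le_div hcos).2 (Real.cos_le_one θ)
  obtain ⟨M, hM⟩ := (isCompact_Icc (a := a) (b := b)).exists_bound_of_continuousOn
    (f := Real.Gamma) (fun x hx => (Real.differentiableAt_Gamma fun m => by
      have : (0 : ℝ) ≤ m := m.cast_nonneg
      linarith [hx.1]).continuousAt.continuousWithinAt)
  refine ⟨(1 / Real.cos θ) ^ b * max M 0, by positivity, fun s h1 h2 _ => ?_⟩
  have hs : 0 < s.re := ha.trans_le h1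
  have hG : Real.Gamma s.re ≤ max M 0 :=
    ((le_abs_self _).trans (hM s.re ⟨h1, h2⟩)).trans (le_max_left _ _)
  have hpow : (1 / Real.cos θ) ^ s.re ≤ (1 / Real.cos θ) ^ b :=
    Real.rpow_le_rpow_of_exponent_le hbase h2
  have hrate : -(Real.pi / 2) + ε = -θ := by ring
  have hΓ := (Real.Gamma_pos_of_pos hs).le
  rw [hrate]
  -- The ray is rotated according to the sign of `Im s`, so that the exponential factor decays in
  -- both cases.
  rcases le_total 0 s.im with h | h
  · refine (norm_Gamma_le_of_abs_lt hs (θ := θ) (abs_lt.2 ⟨by linarith, by linarith⟩)).trans ?_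
    rw [abs_of_nonneg h, neg_mul]
    gcongr
  · refine (norm_Gamma_le_of_abs_lt hs (θ := -θ) (abs_lt.2 ⟨by linarith, by linarith⟩)).trans ?_
    rw [abs_of_nonpos h, neg_mul_neg, Real.cos_neg, show -(-θ * s.im) = θ * s.im by ring]
    gcongr

/-- `Γ` decays in every vertical strip, with any rate below `π / 2`. -/
theorem stripBound_Gamma (a b : ℝ) {ε : ℝ} (hε : 0 < ε) :
    StripBound Gamma a b (-(Real.pi / 2) + ε) := by
  obtain ⟨n, hn⟩ := exists_nat_gt (-a)
  induction n generalizing a b with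
  | zero => exact stripBound_Gamma_of_pos (by simpa using hn) hε
  | succ n ih =>
    -- Since `Γ(s+1) = sΓ(s)` and `|s| ≥ |Im s| ≥ 1`, a bound on the strip shifted right by 1 also
    -- bounds `Γ` here.
    have h := (ih (a + 1) (b + 1) (by push_cast at hn; linarith)).comp_add_const 1
    rw [add_sub_cancel_right, add_sub_cancel_right] at h
    obtain ⟨K, hK, h⟩ := h
    refine ⟨K, hK, fun s h1 h2 h3 => le_trans ?_ (h s h1 h2 h3)⟩
    have hs : 1 ≤ ‖s‖ := h3.trans (abs_im_le_norm s)
    have hs0 : s ≠ 0 := by rintro rfl; norm_num at hs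
    simp only [ofReal_one, Gamma_add_one s hs0, norm_mul]
    exact le_mul_of_one_le_left (norm_nonneg _) hs

/-! ### Growth of the Riemann zeta function in vertical strips -/

/-- The difference between a term of `(s - 1) ∑ n ^ (-s)` and the corresponding integral. -/
noncomputable def zetaTerm (n : ℕ) (s : ℂ) : ℂ :=
  (s - 1) * ((n + 1 : ℝ) : ℂ) ^ (-s) -
    (((n + 1 : ℝ) : ℂ) ^ (1 - s) - ((n + 2 : ℝ) : ℂ) ^ (1 - s))

lemma hasDerivAt_real_cpow_const {x : ℝ} (hx : 0 < x) (r : ℂ) :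
    HasDerivAt (fun y : ℝ => (y : ℂ) ^ r) (r * (x : ℂ) ^ (r - 1)) x := by
  have h : HasDerivAt (fun z : ℂ => z ^ r) (r * (x : ℂ) ^ (r - 1) * 1) (x : ℂ) :=
    (hasDerivAt_id (x : ℂ)).cpow_const (Or.inl (by simpa using hx))
  simpa using h.comp_ofReal

lemma norm_cpow_neg_sub_cpow_neg_le {s : ℂ} (hs : 0 < s.re) {a x : ℝ} (ha : 0 < a)
    (hx : x ∈ Icc a (a + 1)) :
    ‖(x : ℂ) ^ (-s) - (a : ℂ) ^ (-s)‖ ≤ ‖s‖ * a ^ (-s.re - 1) := by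
  have h := norm_image_sub_le_of_norm_deriv_le_segment' (f := fun y : ℝ => (y : ℂ) ^ (-s))
    (f' := fun y => -s * (y : ℂ) ^ (-s - 1)) (a := a) (b := a + 1) (C := ‖s‖ * a ^ (-s.re - 1))
    (fun y hy => (hasDerivAt_real_cpow_const (ha.trans_le hy.1) _).hasDerivWithinAt)
    (fun y hy => by
      rw [norm_mul, norm_neg, norm_cpow_eq_rpow_re_of_pos (ha.trans_le hy.1)]
      refine mul_le_mul_of_nonneg_left ?_ (norm_nonneg _)
      simpa using Real.rpow_le_rpow_of_nonpos ha hy.1 (by linarith : -s.re - 1 ≤ 0)) x hx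
  refine h.trans (mul_le_of_le_one_right (by positivity) (by linarith [hx.2]))

/-- With `a = n + 1`, the term is the increment over `[a, a+1]` of `y ↦ (s-1) a^(-s) y + y^(1-s)`,
whose derivative `(s-1)(a^(-s) - y^(-s))` is small. The extra power of `a` gives convergence for `Re
s > 0`. -/
lemma norm_zetaTerm_le (n : ℕ) {s : ℂ} (hs : 0 < s.re) :
    ‖zetaTerm n s‖ ≤ ‖s - 1‖ * ‖s‖ * ((n : ℝ) + 1) ^ (-s.re - 1) := by
  set a : ℝ := n + 1 with ha
  have hapos : 0 < a := by positivity
  have h := norm_image_sub_le_of_norm_deriv_le_segment'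
    (f := fun y : ℝ => (y : ℂ) * ((s - 1) * (a : ℂ) ^ (-s)) + (y : ℂ) ^ (1 - s))
    (f' := fun y => (s - 1) * ((a : ℂ) ^ (-s) - (y : ℂ) ^ (-s))) (a := a) (b := a + 1)
    (C := ‖s - 1‖ * (‖s‖ * a ^ (-s.re - 1)))
    (fun y hy => by
      have h1 := hasDerivAt_real_cpow_const (hapos.trans_le hy.1) (1 - s)
      have h2 := (hasDerivAt_id y).ofReal_comp.mul_const ((s - 1) * (a : ℂ) ^ (-s))
      refine HasDerivAt.hasDerivWithinAt ?_
      convert! h2.add h1 using 1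
      rw [show (1 - s - 1 : ℂ) = -s by ring]
      push_cast
      ring)
    (fun y hy => by
      rw [norm_mul, norm_sub_rev ((a : ℂ) ^ (-s))]
      exact mul_le_mul_of_nonneg_left
        (norm_cpow_neg_sub_cpow_neg_le hs hapos (Ico_subset_Icc_self hy)) (norm_nonneg _))
    (a + 1) ⟨by linarith, le_rfl⟩
  rw [add_sub_cancel_left, mul_one] at h
  rw [mul_assoc]
  refine le_of_eq_of_le (congrArg norm ?_) h
  rw [zetaTerm, ← ha, show (n + 2 : ℝ) = a + 1 by rw [ha]; ring]
  push_cast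
  ring

lemma summable_add_one_rpow {r : ℝ} (hr : r < -1) : Summable fun n : ℕ => ((n : ℝ) + 1) ^ r := by
  have := (summable_nat_add_iff 1).2 (Real.summable_nat_rpow.2 hr)
  simpa using this

lemma tsum_zetaTerm_of_one_lt_re {s : ℂ} (hs : 1 < s.re) :
    ∑' n, zetaTerm n s = (s - 1) * riemannZeta s - 1 := by
  have hsum : Summable fun n => zetaTerm n s :=
    Summable.of_norm_bounded ((summable_add_one_rpow (by linarith)).mul_left _)
      fun n => norm_zetaTerm_le n (by linarith)
  have hz : Summable fun n : ℕ => ((n + 1 : ℝ) : ℂ) ^ (-s) := by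
    have := (summable_nat_add_iff 1).2 (Complex.summable_one_div_nat_cpow.2 hs)
    refine this.congr fun n => ?_
    rw [cpow_neg, one_div]
    push_cast
    rfl
  have hzeta : ∑' n : ℕ, ((n + 1 : ℝ) : ℂ) ^ (-s) = riemannZeta s := by
    rw [zeta_eq_tsum_one_div_nat_add_one_cpow hs]
    refine tsum_congr fun n => ?_
    rw [cpow_neg, one_div]
    push_cast
    rfl
  have hpart : ∀ N : ℕ, ∑ n ∈ Finset.range N, zetaTerm n s =
      (s - 1) * ∑ n ∈ Finset.range N, ((n + 1 : ℝ) : ℂ) ^ (-s) -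
        (1 - ((N + 1 : ℝ) : ℂ) ^ (1 - s)) := by
    intro N
    induction N with
    | zero => simp
    | succ N ih =>
      rw [Finset.sum_range_succ, ih, Finset.sum_range_succ, zetaTerm,
        show (((N + 1 : ℕ) : ℝ) + 1) = (N + 2 : ℝ) by push_cast; ring]
      ring
  have hvan : Tendsto (fun N : ℕ => ((N + 1 : ℝ) : ℂ) ^ (1 - s)) atTop (𝓝 0) := by
    rw [tendsto_zero_iff_norm_tendsto_zero]
    have : Tendsto (fun N : ℕ => ((N : ℝ) + 1) ^ (-(s.re - 1))) atTop (𝓝 0) :=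
      (tendsto_rpow_neg_atTop (by linarith)).comp
        (tendsto_atTop_add_const_right _ _ tendsto_natCast_atTop_atTop)
    refine this.congr fun N => ?_
    rw [norm_cpow_eq_rpow_re_of_pos (by positivity)]
    simp
  have h1 := hsum.hasSum.tendsto_sum_nat
  have h2 := ((hzeta ▸ hz.hasSum.tendsto_sum_nat).const_mul (s - 1)).sub (hvan.const_sub 1)
  rw [sub_zero] at h2
  exact tendsto_nhds_unique h1 (h2.congr fun N => (hpart N).symm)

lemma differentiable_zetaTerm (n : ℕ) : Differentiable ℂ (zetaTerm n) := by
  have h : ∀ x : ℝ, 0 < x → ∀ f : ℂ → ℂ, Differentiable ℂ f →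
      Differentiable ℂ fun s => (x : ℂ) ^ f s := fun x hx f hf =>
    hf.const_cpow (Or.inl (by exact_mod_cast hx.ne'))
  unfold zetaTerm
  refine ((differentiable_id.sub_const 1).mul (h _ (by positivity) _ differentiable_id.neg)).sub ?_
  exact (h _ (by positivity) _ (differentiable_id.const_sub 1)).sub
    (h _ (by positivity) _ (differentiable_id.const_sub 1))

lemma sub_one_mul_riemannZeta_eq {s : ℂ} (hs : 1 / 2 ≤ s.re) (hs1 : s ≠ 1) :
    (s - 1) * riemannZeta s = 1 + ∑' n, zetaTerm n s := by
  set R : ℝ := ‖s‖ + 3 with hR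
  -- The ball keeps `‖z - 1‖ ‖z‖` bounded for the M-test; it is large enough to contain both `s` and
  -- the point 2, near which the identity is already known.
  set U : Set ℂ := {z : ℂ | 1 / 4 < z.re} ∩ Metric.ball 0 R with hU
  have hopen : IsOpen U := (isOpen_lt continuous_const continuous_re).inter Metric.isOpen_ball
  have hconv : Convex ℝ U := (convex_halfSpace_re_gt _).inter (convex_ball _ _)
  have hsum : DifferentiableOn ℂ (fun z => ∑' n, zetaTerm n z) U := by
    refine differentiableOn_tsum_of_summable_norm
      (u := fun n : ℕ => (R + 1) * R * ((n : ℝ) + 1) ^ (-(5 / 4) : ℝ))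
      ((summable_add_one_rpow (by norm_num)).mul_left _)
      (fun n => (differentiable_zetaTerm n).differentiableOn) hopen fun n z hz => ?_
    have h1 : 1 / 4 < z.re := hz.1
    have h2 : ‖z‖ < R := by simpa using hz.2
    have h3 : ‖z - 1‖ ≤ R + 1 := (norm_sub_le _ _).trans (by simpa using h2.le)
    refine (norm_zetaTerm_le n (by linarith)).trans ?_
    have h4 : ((n : ℝ) + 1) ^ (-z.re - 1) ≤ ((n : ℝ) + 1) ^ (-(5 / 4) : ℝ) :=
      Real.rpow_le_rpow_of_exponent_le (by linarith [n.cast_nonneg (α := ℝ)]) (by linarith)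
    gcongr
  have h₁ : ∀ z : ℂ, z ≠ 1 → riemannZeta₁ z = (z - 1) * riemannZeta z := fun z hz => by
    rw [riemannZeta_eq_inv_sub_mul hz, mul_inv_cancel_left₀ (sub_ne_zero.2 hz)]
  have hmem : (2 : ℂ) ∈ U := ⟨by norm_num, by simp [hR]; linarith [norm_nonneg s]⟩
  have heq : EqOn riemannZeta₁ (fun z => 1 + ∑' n, zetaTerm n z) U := by
    refine (differentiable_riemannZeta₁.differentiableOn.analyticOnNhd hopen)
      |>.eqOn_of_preconnected_of_eventuallyEq ((hsum.const_add 1).analyticOnNhd hopen)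
        hconv.isPreconnected hmem ?_
    filter_upwards [(isOpen_lt continuous_const continuous_re).mem_nhds
      (show (1 : ℝ) < (2 : ℂ).re by norm_num)] with z hz
    have hz' : 1 < z.re := hz
    rw [tsum_zetaTerm_of_one_lt_re hz', h₁ z (by rintro rfl; norm_num at hz')]
    ring
  rw [← h₁ s hs1]
  exact heq ⟨by simp; linarith, by simp [hR]⟩

lemma norm_riemannZeta_le {s : ℂ} (hs : 1 / 2 ≤ s.re) (him : 1 ≤ |s.im|) :
    ‖riemannZeta s‖ ≤ 1 + ‖s‖ * ∑' n : ℕ, ((n : ℝ) + 1) ^ (-(3 / 2) : ℝ) := by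
  have hs1 : 1 ≤ ‖s - 1‖ := him.trans (by simpa using abs_im_le_norm (s - 1))
  have hne : s ≠ 1 := by rintro rfl; norm_num at him
  have hsum := summable_add_one_rpow (r := -(3 / 2)) (by norm_num)
  have hb : ‖∑' n, zetaTerm n s‖ ≤
      ‖s - 1‖ * ‖s‖ * ∑' n : ℕ, ((n : ℝ) + 1) ^ (-(3 / 2) : ℝ) := by
    refine tsum_of_norm_bounded (hsum.hasSum.mul_left _) fun n => ?_
    refine (norm_zetaTerm_le n (by linarith)).trans ?_
    have h4 : ((n : ℝ) + 1) ^ (-s.re - 1) ≤ ((n : ℝ) + 1) ^ (-(3 / 2) : ℝ) :=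
      Real.rpow_le_rpow_of_exponent_le (by linarith [n.cast_nonneg (α := ℝ)]) (by linarith)
    gcongr
  have hprod : ‖s - 1‖ * ‖riemannZeta s‖ ≤
      ‖s - 1‖ * (1 + ‖s‖ * ∑' n : ℕ, ((n : ℝ) + 1) ^ (-(3 / 2) : ℝ)) := by
    rw [← norm_mul, sub_one_mul_riemannZeta_eq hs hne]
    refine (norm_add_le _ _).trans ?_
    rw [norm_one, mul_add, mul_one, ← mul_assoc]
    exact add_le_add hs1 hb
  exact le_of_mul_le_mul_left hprod (by linarith)

lemma stripBound_riemannZeta_of_half_le {a b ε : ℝ} (ha : 1 / 2 ≤ a) (hε : 0 < ε) :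
    StripBound riemannZeta a b ε := by
  set Z := ∑' n : ℕ, ((n : ℝ) + 1) ^ (-(3 / 2) : ℝ)
  have hZ : 0 ≤ Z := tsum_nonneg fun n => by positivity
  refine ⟨1 + (|b| + ε⁻¹) * Z, by positivity, fun s h1 h2 h3 => ?_⟩
  refine (norm_riemannZeta_le (ha.trans h1) h3).trans ?_
  have hexp : 1 ≤ Real.exp (ε * |s.im|) := Real.one_le_exp (by positivity)
  have him : |s.im| ≤ ε⁻¹ * Real.exp (ε * |s.im|) := by
    rw [inv_mul_eq_div, le_div_iff₀ hε]
    linarith [Real.add_one_le_exp (ε * |s.im|)]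
  have hre : |s.re| ≤ |b| * Real.exp (ε * |s.im|) := by
    rw [abs_of_nonneg (by linarith)]
    exact (h2.trans (le_abs_self b)).trans (le_mul_of_one_le_right (abs_nonneg b) hexp)
  have hnorm := norm_le_abs_re_add_abs_im s
  calc 1 + ‖s‖ * Z ≤ Real.exp (ε * |s.im|) + (|b| + ε⁻¹) * Real.exp (ε * |s.im|) * Z := by
        gcongr
        linarith
    _ = _ := by ring

/-- `ζ` grows subexponentially in every vertical strip. -/
theorem stripBound_riemannZeta (a b : ℝ) {ε : ℝ} (hε : 0 < ε) : StripBound riemannZeta a b ε := by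
  refine StripBound.union (m := 1 / 2) ?_ (stripBound_riemannZeta_of_half_le le_rfl hε)
  -- Left of `1/2` the functional equation applies: the decay of `Γ` and the growth of the cosine
  -- cancel at rate `π/2`, leaving `ε/2` from `Γ` and `ε/2` from `ζ`.
  have hR : StripBound (fun s => 2 * (((2 * Real.pi : ℝ) : ℂ) ^ (((-1 : ℝ) : ℂ) * s + 0)) *
      Gamma s * cos (Real.pi * s / 2) * riemannZeta s) (1 / 2) (1 - a) ε := by
    have h := ((((StripBound.const 2).mul
      (stripBound_cpow Real.two_pi_pos (-1) 0 _ _)).mul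
      (stripBound_Gamma (1 / 2) (1 - a) (half_pos hε))).mul (stripBound_cos _ _)).mul
      (stripBound_riemannZeta_of_half_le le_rfl (half_pos hε))
    exact h.mono le_rfl le_rfl (by linarith)
  have h := hR.comp_const_sub 1
  rw [sub_sub_cancel, show (1 - 1 / 2 : ℝ) = 1 / 2 by norm_num] at h
  refine h.congr fun s _ _ him => ?_
  have hs : ∀ n : ℕ, (1 - s) ≠ -n := fun n hn => him (by
    have := congrArg Complex.im hn
    simpa using this)
  have h1s : (1 - s) ≠ 1 := fun hn => him (by
    have := congrArg Complex.im hn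
    simpa using this)
  have := riemannZeta_one_sub hs h1s
  rw [sub_sub_cancel] at this
  rw [this]
  push_cast
  ring_nf

/-! ### Moving the line of integration -/

/-- The closed vertical strip `a ≤ Re s ≤ b`. -/
def strip (a b : ℝ) : Set ℂ := {s | a ≤ s.re ∧ s.re ≤ b}

/-- `f` tends to zero in the strip `a ≤ Re s ≤ b` as `|Im s| → ∞`. -/
def StripVanish (f : ℂ → ℂ) (a b : ℝ) : Prop :=
  ∀ η > 0, ∃ T₀ : ℝ, ∀ s : ℂ, a ≤ s.re → s.re ≤ b → T₀ ≤ |s.im| → ‖f s‖ ≤ η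

/-- The difference of the truncated integrals over the two sides of a strip. -/
noncomputable def sideDiff (f : ℂ → ℂ) (a b T : ℝ) : ℂ :=
  (∫ t in (-T)..T, f (b + t * I)) - ∫ t in (-T)..T, f (a + t * I)

lemma line_mem_strip_left {a b : ℝ} (hab : a ≤ b) (t : ℝ) : (a + t * I : ℂ) ∈ strip a b := by
  simp [strip, hab]

lemma line_mem_strip_right {a b : ℝ} (hab : a ≤ b) (t : ℝ) : (b + t * I : ℂ) ∈ strip a b := by
  simp [strip, hab]

lemma strip_mem_nhds {a b : ℝ} {p : ℂ} (ha : a < p.re) (hb : p.re < b) : strip a b ∈ 𝓝 p := by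
  refine mem_of_superset (((isOpen_lt continuous_const continuous_re).inter
    (isOpen_lt continuous_re continuous_const)).mem_nhds ⟨ha, hb⟩) ?_
  exact fun s hs => ⟨le_of_lt hs.1, le_of_lt hs.2⟩

lemma StripVanish.add {f g : ℂ → ℂ} {a b : ℝ} (hf : StripVanish f a b) (hg : StripVanish g a b) :
    StripVanish (fun s => f s + g s) a b := by
  intro η hη
  obtain ⟨T₁, h₁⟩ := hf (η / 2) (half_pos hη)
  obtain ⟨T₂, h₂⟩ := hg (η / 2) (half_pos hη)
  refine ⟨max T₁ T₂, fun s ha hb hs => ?_⟩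
  have h1 := h₁ s ha hb ((le_max_left _ _).trans hs)
  have h2 := h₂ s ha hb ((le_max_right _ _).trans hs)
  exact (norm_add_le _ _).trans (by linarith)

lemma StripVanish.congr {f g : ℂ → ℂ} {a b : ℝ} (hf : StripVanish f a b)
    (hfg : ∀ s ∈ strip a b, s.im ≠ 0 → g s = f s) : StripVanish g a b := by
  intro η hη
  obtain ⟨T, h⟩ := hf η hη
  refine ⟨max T 1, fun s ha hb hs => ?_⟩
  have him : s.im ≠ 0 := by
    rintro h0
    have := (le_max_right T 1).trans hs
    norm_num [h0] at this
  rw [hfg s ⟨ha, hb⟩ him]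
  exact h s ha hb ((le_max_left _ _).trans hs)

lemma stripVanish_const_div_pow (c : ℂ) (p : ℝ) (m : ℕ) (a b : ℝ) :
    StripVanish (fun s => c / (s - p) ^ (m + 1)) a b := by
  intro η hη
  refine ⟨max 1 (‖c‖ / η), fun s _ _ hs => ?_⟩
  have h1 : |s.im| ≤ ‖s - p‖ := by simpa using abs_im_le_norm (s - p)
  have h2 : 1 ≤ ‖s - p‖ := ((le_max_left _ _).trans hs).trans h1
  have h3 : ‖c‖ / η ≤ ‖s - p‖ := ((le_max_right _ _).trans hs).trans h1
  rw [norm_div, norm_pow, div_le_iff₀ (by positivity)]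
  rw [div_le_iff₀ hη, mul_comm] at h3
  refine h3.trans (mul_le_mul_of_nonneg_left ?_ hη.le)
  exact le_self_pow₀ h2 (Nat.succ_ne_zero m)

lemma tendsto_sideDiff_of_differentiableOn {f : ℂ → ℂ} {a b : ℝ} (hab : a ≤ b)
    (hf : DifferentiableOn ℂ f (strip a b)) (hv : StripVanish f a b) :
    Tendsto (sideDiff f a b) atTop (𝓝 0) := by
  rw [Metric.tendsto_atTop]
  intro ε hε
  -- The two horizontal sides have total length `2(b - a)`; the added 1 makes the bound strict and
  -- covers `a = b`.
  obtain ⟨T₀, hT₀⟩ := hv (ε / (2 * (b - a) + 1)) (div_pos hε (by linarith))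
  refine ⟨max T₀ 0, fun T hT => ?_⟩
  have hT0 : 0 ≤ T := (le_max_right _ _).trans hT
  have hTT : T₀ ≤ T := (le_max_left _ _).trans hT
  have hrect := integral_boundary_rect_eq_zero_of_differentiableOn f (a + (-T : ℝ) * I)
    (b + T * I) (hf.mono fun s hs => by
      have h := hs.1
      simp only [mem_preimage] at h
      rw [uIcc_of_le (by simpa using hab)] at h
      simpa [strip] using h)
  simp only [add_re, ofReal_re, mul_re, I_re, mul_zero, ofReal_im, I_im, mul_one, sub_self,
    add_zero, add_im, mul_im, zero_add, smul_eq_mul] at hrect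
  have hhor : ∀ y : ℝ, T₀ ≤ |y| → ‖∫ x : ℝ in a..b, f (x + y * I)‖ ≤
      ε / (2 * (b - a) + 1) * |b - a| := fun y hy => by
    refine intervalIntegral.norm_integral_le_of_norm_le_const fun x hx => ?_
    rw [uIoc_of_le hab] at hx
    exact hT₀ _ (by simpa using hx.1.le) (by simpa using hx.2) (by simpa using hy)
  have h1 := hhor (-T) (by rwa [abs_neg, abs_of_nonneg hT0])
  have h2 := hhor T (by rwa [abs_of_nonneg hT0])
  have heq : I * sideDiff f a b T =
      (∫ x : ℝ in a..b, f (x + T * I)) - ∫ x : ℝ in a..b, f (x + (-T : ℝ) * I) := by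
    rw [sideDiff]
    linear_combination hrect
  have hn : ‖sideDiff f a b T‖ = ‖I * sideDiff f a b T‖ := by simp
  rw [dist_zero_right, hn, heq]
  refine (norm_sub_le _ _).trans_lt ((add_le_add h2 h1).trans_lt ?_)
  rw [abs_of_nonneg (by linarith), ← mul_add, div_mul_eq_mul_div, div_lt_iff₀ (by linarith)]
  nlinarith

lemma add_mul_I_ne_zero {c : ℝ} (hc : c ≠ 0) (t : ℝ) : (c + t * I : ℂ) ≠ 0 := fun h => hc (by
  simpa using congrArg Complex.re h)

lemma hasDerivAt_line (c t : ℝ) : HasDerivAt (fun t : ℝ => (c + t * I : ℂ)) I t := by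
  simpa using ((hasDerivAt_id t).ofReal_comp.mul_const I).const_add (c : ℂ)

/-- An antiderivative is `-i log(c + ti)`. Writing `log(c ± iT) = log T + log(c/T ± i)` cancels `log
T`, and the limit is `-i(log i - log(-i)) = π`. -/
lemma tendsto_integral_inv_line_of_pos {c : ℝ} (hc : 0 < c) :
    Tendsto (fun T : ℝ => ∫ t in (-T)..T, (c + t * I : ℂ)⁻¹) atTop (𝓝 Real.pi) := by
  have hslit : ∀ t : ℝ, (c + t * I : ℂ) ∈ slitPlane := fun t => Or.inl (by simpa using hc)
  have hint : ∀ T : ℝ, ∫ t in (-T)..T, (c + t * I : ℂ)⁻¹ =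
      -I * log (c + T * I) - -I * log (c + (-T : ℝ) * I) := fun T => by
    refine intervalIntegral.integral_eq_sub_of_hasDerivAt (f := fun t : ℝ => -I * log (c + t * I))
      (fun t _ => ?_) ?_
    · convert! ((hasDerivAt_line c t).clog_real (hslit t)).const_mul (-I) using 1
      rw [← mul_div_assoc, neg_mul, I_mul_I, neg_neg, one_div]
    · exact (Continuous.inv₀ (by fun_prop) (add_mul_I_ne_zero hc.ne')).intervalIntegrable _ _
  have hlim : ∀ σ : ℂ, σ ∈ slitPlane → Tendsto (fun T : ℝ => log ((c / T : ℝ) + σ)) atTop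
      (𝓝 (log σ)) := fun σ hσ => by
    have h0 : Tendsto (fun T : ℝ => ((c / T : ℝ) : ℂ) + σ) atTop (𝓝 (0 + σ)) := by
      have := (continuous_ofReal.tendsto 0).comp (tendsto_const_nhds (x := c).div_atTop tendsto_id)
      simpa using this.add_const σ
    rw [zero_add] at h0
    exact h0.clog hσ
  have hmain := ((hlim I (Or.inr (by simp))).const_mul (-I)).sub
    ((hlim (-I) (Or.inr (by simp))).const_mul (-I))
  have hval : -I * log I - -I * log (-I) = Real.pi := by
    rw [log_I, log_neg_I]
    linear_combination (-(Real.pi : ℂ)) * I_mul_I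
  rw [hval] at hmain
  refine hmain.congr' ?_
  filter_upwards [eventually_gt_atTop 0] with T hT
  have hT' : (T : ℂ) ≠ 0 := by exact_mod_cast hT.ne'
  rw [hint]
  have hsc : ∀ σ : ℂ, σ.im ≠ 0 → log (c + T * σ) = Real.log T + log ((c / T : ℝ) + σ) := by
    intro σ hσ
    rw [← log_ofReal_mul hT (fun h => hσ (by simpa using congrArg Complex.im h))]
    congr 1
    push_cast
    field_simp
  rw [hsc I (by simp), show ((-T : ℝ) : ℂ) * I = T * -I by push_cast; ring, hsc (-I) (by simp)]
  ring

lemma tendsto_integral_inv_line_of_neg {c : ℝ} (hc : c < 0) :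
    Tendsto (fun T : ℝ => ∫ t in (-T)..T, (c + t * I : ℂ)⁻¹) atTop (𝓝 (-Real.pi)) := by
  refine (tendsto_integral_inv_line_of_pos (neg_pos.2 hc)).neg.congr fun T => ?_
  have h := intervalIntegral.integral_comp_neg (a := -T) (b := T)
    (fun t : ℝ => ((-c : ℝ) + t * I : ℂ)⁻¹)
  rw [neg_neg] at h
  rw [← h, ← intervalIntegral.integral_neg]
  refine intervalIntegral.integral_congr fun t _ => ?_
  rw [← inv_neg]
  push_cast
  ring_nf

lemma tendsto_integral_inv_line_pow {c : ℝ} (hc : c ≠ 0) (m : ℕ) :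
    Tendsto (fun T : ℝ => ∫ t in (-T)..T, ((c + t * I : ℂ) ^ (m + 2))⁻¹) atTop (𝓝 0) := by
  have hm : ((m : ℂ) + 1) ≠ 0 := by exact_mod_cast Nat.succ_ne_zero m
  have hint : ∀ T : ℝ, ∫ t in (-T)..T, ((c + t * I : ℂ) ^ (m + 2))⁻¹ =
      I / (m + 1) * ((c + T * I : ℂ) ^ (m + 1))⁻¹ -
        I / (m + 1) * ((c + (-T : ℝ) * I : ℂ) ^ (m + 1))⁻¹ := fun T => by
    refine intervalIntegral.integral_eq_sub_of_hasDerivAt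
      (f := fun t : ℝ => I / (m + 1) * ((c + t * I : ℂ) ^ (m + 1))⁻¹) (fun t _ => ?_) ?_
    · have hne := add_mul_I_ne_zero hc t
      convert! (((hasDerivAt_line c t).pow (m + 1)).inv (pow_ne_zero _ hne)).const_mul
        (I / ((m : ℂ) + 1)) using 1
      simp only [Pi.pow_apply, Nat.add_sub_cancel]
      push_cast
      field_simp
      linear_combination ((c + t * I : ℂ) ^ (2 * m + 2)) * I_sq
    · exact (Continuous.inv₀ (by fun_prop)
        fun t => pow_ne_zero _ (add_mul_I_ne_zero hc t)).intervalIntegrable _ _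
  have hlim : ∀ ε : ℝ, |ε| = 1 →
      Tendsto (fun T : ℝ => ((c + (ε * T : ℝ) * I : ℂ) ^ (m + 1))⁻¹) atTop (𝓝 0) := fun ε hε => by
    rw [tendsto_zero_iff_norm_tendsto_zero]
    refine squeeze_zero' (Eventually.of_forall fun _ => norm_nonneg _) ?_ tendsto_inv_atTop_zero
    filter_upwards [eventually_ge_atTop 1] with T hT
    have h1 : T ≤ ‖(c + (ε * T : ℝ) * I : ℂ)‖ := by
      have := abs_im_le_norm (c + (ε * T : ℝ) * I : ℂ)
      rwa [add_im, ofReal_im, zero_add, im_ofReal_mul, I_im, mul_one, abs_mul, hε, one_mul,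
        abs_of_nonneg (by linarith)] at this
    rw [norm_inv, norm_pow]
    exact inv_anti₀ (by linarith) (h1.trans (le_self_pow₀ (hT.trans h1) (Nat.succ_ne_zero m)))
  have := ((hlim 1 (by simp)).const_mul (I / ((m : ℂ) + 1))).sub
    ((hlim (-1) (by simp)).const_mul (I / ((m : ℂ) + 1)))
  simp only [mul_zero, sub_zero, one_mul, neg_mul] at this
  exact this.congr fun T => by rw [hint]

lemma tendsto_sideDiff_inv_pow {a b p : ℝ} (ha : a < p) (hb : p < b) (c : ℂ) (m : ℕ) :
    Tendsto (sideDiff (fun s => c / (s - p) ^ (m + 1)) a b) atTop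
      (𝓝 (if m = 0 then 2 * Real.pi * c else 0)) := by
  have hside : ∀ T, sideDiff (fun s => c / (s - p) ^ (m + 1)) a b T =
      c * ((∫ t in (-T)..T, (((b - p : ℝ) + t * I : ℂ) ^ (m + 1))⁻¹) -
        ∫ t in (-T)..T, (((a - p : ℝ) + t * I : ℂ) ^ (m + 1))⁻¹) := fun T => by
    rw [sideDiff, mul_sub, ← intervalIntegral.integral_const_mul,
      ← intervalIntegral.integral_const_mul]
    congr 1 <;>
    · refine intervalIntegral.integral_congr fun t _ => ?_
      rw [div_eq_mul_inv]
      push_cast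
      ring_nf
  refine Tendsto.congr (fun T => (hside T).symm) ?_
  rcases m with _ | m
  · have h := ((tendsto_integral_inv_line_of_pos (sub_pos.2 hb)).sub
      (tendsto_integral_inv_line_of_neg (sub_neg.2 ha))).const_mul c
    convert! h using 2
    · simp
    · simp only [if_true]
      ring
  · have h := ((tendsto_integral_inv_line_pow (sub_pos.2 hb).ne' m).sub
      (tendsto_integral_inv_line_pow (sub_neg.2 ha).ne m)).const_mul c
    simpa using h

/-- Passing to the difference quotient shifts the Taylor coefficients at `p` by one. -/
lemma iteratedDeriv_dslope {g : ℂ → ℂ} {p : ℂ} (hg : AnalyticAt ℂ g p) (m : ℕ) :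
    iteratedDeriv m (dslope g p) p / m.factorial =
      iteratedDeriv (m + 1) g p / (m + 1).factorial := by
  have h1 := hg.hasFPowerSeriesAt
  have h2 := h1.has_fpower_series_dslope_fslope
  have h3 := (h2.analyticAt).hasFPowerSeriesAt
  have h := congrArg (fun q => q.coeff m) (h3.eq_formalMultilinearSeries h2)
  simpa [FormalMultilinearSeries.coeff_fslope] using h

lemma sideDiff_add {f g : ℂ → ℂ} {a b T : ℝ}
    (hfa : Continuous fun t : ℝ => f (a + t * I)) (hfb : Continuous fun t : ℝ => f (b + t * I))
    (hga : Continuous fun t : ℝ => g (a + t * I)) (hgb : Continuous fun t : ℝ => g (b + t * I)) :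
    sideDiff (fun s => f s + g s) a b T = sideDiff f a b T + sideDiff g a b T := by
  simp only [sideDiff]
  rw [intervalIntegral.integral_add (hfb.intervalIntegrable _ _) (hgb.intervalIntegrable _ _),
    intervalIntegral.integral_add (hfa.intervalIntegrable _ _) (hga.intervalIntegrable _ _)]
  ring

lemma continuous_line_of_continuousOn {f : ℂ → ℂ} {S : Set ℂ} (hf : ContinuousOn f S) {c : ℝ}
    (hc : ∀ t : ℝ, (c + t * I : ℂ) ∈ S) : Continuous fun t : ℝ => f (c + t * I) := by
  rw [← continuousOn_univ]
  exact hf.comp (by fun_prop) fun t _ => hc t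

/-- Induction on the pole order: `g(s) = g(p) + (s - p) dslope g p s` peels off `g(p)/(s-p)^(m+1)`,
which contributes in the limit only when `m = 0`. Truncated integrals are needed because `1/(s-p)`
alone is not integrable on a vertical line. -/
lemma tendsto_sideDiff_div_pow {a b p : ℝ} (ha : a < p) (hb : p < b) (m : ℕ) {g : ℂ → ℂ}
    (hg : DifferentiableOn ℂ g (strip a b))
    (hv : StripVanish (fun s => g s / (s - p) ^ (m + 1)) a b) :
    Tendsto (sideDiff (fun s => g s / (s - p) ^ (m + 1)) a b) atTop
      (𝓝 (2 * Real.pi * (iteratedDeriv m g p / m.factorial))) := by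
  have hab : a ≤ b := (ha.trans hb).le
  have hnhds : strip a b ∈ 𝓝 (p : ℂ) := strip_mem_nhds (by simpa using ha) (by simpa using hb)
  have hne : ∀ c : ℝ, c ≠ p → ∀ t : ℝ, (c + t * I : ℂ) - p ≠ 0 := fun c hc t h =>
    hc (by simpa [sub_eq_zero] using congrArg Complex.re h)
  have hpc : ∀ (v : ℂ) (n : ℕ) (c : ℝ), c ≠ p →
      Continuous fun t : ℝ => v / ((c + t * I : ℂ) - p) ^ n := fun v n c hc =>
    Continuous.div continuous_const (by fun_prop) fun t => pow_ne_zero _ (hne c hc t)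
  have hslope : ∀ (g : ℂ → ℂ) (s : ℂ), s ≠ p → g s = g p + (s - p) * dslope g p s := fun g s hs => by
    rw [dslope_of_ne _ hs, slope_def_field, mul_div_cancel₀ _ (sub_ne_zero.2 hs)]
    ring
  induction m generalizing g with
  | zero =>
    set h := dslope g p with hh
    have hd : DifferentiableOn ℂ h (strip a b) := (differentiableOn_dslope hnhds).2 hg
    have hsplit : ∀ s : ℂ, s ≠ p → g s / (s - p) ^ (0 + 1) = g p / (s - p) ^ (0 + 1) + h s :=
      fun s hs => by
        have := sub_ne_zero.2 hs
        rw [hslope g s hs]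
        field_simp
        ring
    have hvh : StripVanish h a b := by
      refine (hv.add (stripVanish_const_div_pow (-g p) p 0 a b)).congr fun s _ him => ?_
      rw [hsplit s (fun h => him (by simp [h]))]
      ring
    have hlim := (tendsto_sideDiff_inv_pow ha hb (g p) 0).add
      (tendsto_sideDiff_of_differentiableOn hab hd hvh)
    simp only [if_true, add_zero] at hlim
    simp only [iteratedDeriv_zero, Nat.factorial_zero, Nat.cast_one, div_one]
    refine hlim.congr fun T => ?_
    rw [← sideDiff_add (hpc _ _ a ha.ne) (hpc _ _ b hb.ne')
      (continuous_line_of_continuousOn hd.continuousOn (line_mem_strip_left hab))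
      (continuous_line_of_continuousOn hd.continuousOn (line_mem_strip_right hab))]
    simp only [sideDiff]
    congr 1 <;> refine intervalIntegral.integral_congr fun t _ => ?_
    · exact (hsplit _ (sub_ne_zero.1 (hne b hb.ne' t))).symm
    · exact (hsplit _ (sub_ne_zero.1 (hne a ha.ne t))).symm
  | succ m ih =>
    set h := dslope g p with hh
    have hd : DifferentiableOn ℂ h (strip a b) := (differentiableOn_dslope hnhds).2 hg
    have hsplit : ∀ s : ℂ, s ≠ p → g s / (s - p) ^ (m + 1 + 1) =
        g p / (s - p) ^ (m + 1 + 1) + h s / (s - p) ^ (m + 1) :=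
      fun s hs => by
        have := sub_ne_zero.2 hs
        rw [hslope g s hs]
        field_simp
        ring
    have hvh : StripVanish (fun s => h s / (s - p) ^ (m + 1)) a b := by
      refine (hv.add (stripVanish_const_div_pow (-g p) p (m + 1) a b)).congr fun s _ him => ?_
      rw [hsplit s (fun h => him (by simp [h]))]
      ring
    have hhc : ∀ c : ℝ, c ≠ p → (∀ t : ℝ, (c + t * I : ℂ) ∈ strip a b) →
        Continuous fun t : ℝ => h (c + t * I) / ((c + t * I : ℂ) - p) ^ (m + 1) := fun c hc hm =>
      (continuous_line_of_continuousOn hd.continuousOn hm).div (by fun_prop)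
        fun t => pow_ne_zero _ (hne c hc t)
    have hlim := (tendsto_sideDiff_inv_pow ha hb (g p) (m + 1)).add (ih hd hvh)
    rw [if_neg (Nat.succ_ne_zero m), zero_add, hh, iteratedDeriv_dslope (hg.analyticAt hnhds)]
      at hlim
    refine hlim.congr fun T => ?_
    rw [← sideDiff_add (hpc _ _ a ha.ne) (hpc _ _ b hb.ne') (hhc a ha.ne (line_mem_strip_left hab))
      (hhc b hb.ne' (line_mem_strip_right hab))]
    simp only [sideDiff]
    congr 1 <;> refine intervalIntegral.integral_congr fun t _ => ?_
    · exact (hsplit _ (sub_ne_zero.1 (hne b hb.ne' t))).symm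
    · exact (hsplit _ (sub_ne_zero.1 (hne a ha.ne t))).symm

lemma tendsto_sideDiff_of_integrable {f : ℂ → ℂ} {a b : ℝ}
    (ha : Integrable fun t : ℝ => f (a + t * I)) (hb : Integrable fun t : ℝ => f (b + t * I)) :
    Tendsto (sideDiff f a b) atTop
      (𝓝 ((∫ t : ℝ, f (b + t * I)) - ∫ t : ℝ, f (a + t * I))) :=
  (intervalIntegral_tendsto_integral hb tendsto_neg_atTop_atBot tendsto_id).sub
    (intervalIntegral_tendsto_integral ha tendsto_neg_atTop_atBot tendsto_id)

/-- Moving the line of integration without crossing a pole. -/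
theorem integral_line_eq {f : ℂ → ℂ} {a b : ℝ} (hab : a ≤ b)
    (hf : DifferentiableOn ℂ f (strip a b)) (hv : StripVanish f a b)
    (ha : Integrable fun t : ℝ => f (a + t * I)) (hb : Integrable fun t : ℝ => f (b + t * I)) :
    ∫ t : ℝ, f (b + t * I) = ∫ t : ℝ, f (a + t * I) :=
  sub_eq_zero.1 <| tendsto_nhds_unique (tendsto_sideDiff_of_integrable ha hb)
    (tendsto_sideDiff_of_differentiableOn hab hf hv)

/-- Moving the line of integration across a pole of order at most `m + 1`. -/
theorem integral_line_sub_eq {f g : ℂ → ℂ} {a b p : ℝ} (hap : a < p) (hpb : p < b) (m : ℕ)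
    (hg : DifferentiableOn ℂ g (strip a b))
    (hfg : ∀ s ∈ strip a b, s ≠ p → f s = g s / (s - p) ^ (m + 1)) (hv : StripVanish f a b)
    (ha : Integrable fun t : ℝ => f (a + t * I)) (hb : Integrable fun t : ℝ => f (b + t * I)) :
    (∫ t : ℝ, f (b + t * I)) - ∫ t : ℝ, f (a + t * I) =
      2 * Real.pi * (iteratedDeriv m g p / m.factorial) := by
  have hab : a ≤ b := (hap.trans hpb).le
  have hne : ∀ c : ℝ, c ≠ p → ∀ t : ℝ, (c + t * I : ℂ) ≠ p := fun c hc t h =>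
    hc (by simpa using congrArg Complex.re h)
  refine tendsto_nhds_unique (tendsto_sideDiff_of_integrable ha hb)
    ((tendsto_sideDiff_div_pow hap hpb m hg (hv.congr fun s hs him => ?_)).congr fun T => ?_)
  · exact (hfg s hs fun h => him (by simp [h])).symm
  · simp only [sideDiff]
    congr 1 <;> refine intervalIntegral.integral_congr fun t _ => ?_
    · exact (hfg _ (line_mem_strip_right hab t) (hne b hpb.ne' t)).symm
    · exact (hfg _ (line_mem_strip_left hab t) (hne a hap.ne t)).symm

/-! ### Dirichlet series of the Piltz divisor functions -/

lemma piltz_zero_left (n : ℕ) : piltz 0 n = if n = 1 then 1 else 0 := by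
  split_ifs with h
  · subst h
    rw [piltz, Nat.finMulAntidiag_one, Finset.card_singleton]
  · simp [piltz, Nat.finMulAntidiag_zero_left h]

/-- Tuples are fibred over the pair formed by the first entry and the product of the others. This is
Dirichlet convolution with 1, so each step multiplies the Dirichlet series by `ζ`. -/
lemma piltz_succ (k n : ℕ) : piltz (k + 1) n = ∑ p ∈ n.divisorsAntidiagonal, piltz k p.2 := by
  rw [piltz, Finset.card_eq_sum_card_fiberwise (f := fun v => (v 0, ∏ i : Fin k, v i.succ))
    (t := n.divisorsAntidiagonal)]
  · refine Finset.sum_congr rfl fun p hp => ?_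
    rw [Nat.mem_divisorsAntidiagonal] at hp
    have hp2 : p.2 ≠ 0 := fun h => hp.2 (by rw [← hp.1, h, mul_zero])
    refine Finset.card_nbij' (fun v i => v i.succ) (fun v => Fin.cons p.1 v) ?_ ?_ ?_ ?_
    · intro v hv
      obtain ⟨-, hv⟩ := Finset.mem_filter.1 hv
      refine Nat.mem_finMulAntidiag.2 ⟨congrArg Prod.snd hv, hp2⟩
    · intro v hv
      have hv := Nat.mem_finMulAntidiag.1 hv
      refine Finset.mem_filter.2 ⟨Nat.mem_finMulAntidiag.2 ⟨?_, hp.2⟩, ?_⟩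
      · rw [Fin.prod_univ_succ]
        simp [hv.1, hp.1]
      · simp [hv.1]
    · intro v hv
      obtain ⟨-, hv⟩ := Finset.mem_filter.1 hv
      have h0 : v 0 = p.1 := congrArg Prod.fst hv
      simp only [← h0]
      exact Fin.cons_self_tail v
    · intro v _
      simp
  · intro v hv
    have hv := Nat.mem_finMulAntidiag.1 hv
    refine Nat.mem_divisorsAntidiagonal.2 ⟨?_, hv.2⟩
    rw [← hv.1, Fin.prod_univ_succ]

lemma lSeriesHasSum_piltz (k : ℕ) {s : ℂ} (hs : 1 < s.re) :
    LSeriesHasSum (fun n => (piltz k n : ℂ)) s (riemannZeta s ^ k) := by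
  induction k with
  | zero =>
    have h : HasSum (LSeries.term (fun n => (piltz 0 n : ℂ)) s)
        (LSeries.term (fun n => (piltz 0 n : ℂ)) s 1) := hasSum_single 1 fun n hn => by
      rcases eq_or_ne n 0 with rfl | h0
      · simp
      · simp [LSeries.term_of_ne_zero h0, piltz_zero_left, hn]
    rw [LSeries.term_of_ne_zero one_ne_zero] at h
    simpa [LSeriesHasSum, piltz_zero_left] using h
  | succ k ih =>
    have h1 : LSeriesHasSum (1 : ℕ → ℂ) s (riemannZeta s) :=
      (LSeriesHasSum_congr _ _ (fun {n} hn => by simp [hn])).1 (ArithmeticFunction.LSeriesHasSum_zeta hs)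
    have h := h1.convolution ih
    rw [pow_succ']
    refine (LSeriesHasSum_congr _ _ fun {n} hn => ?_).1 h
    rw [LSeries.convolution_def, piltz_succ]
    push_cast
    refine Finset.sum_congr rfl fun p hp => ?_
    simp

/-- The Dirichlet series of `d_k` is `ζ ^ k`. -/
theorem hasSum_piltz (k : ℕ) {s : ℂ} (hs : 1 < s.re) :
    HasSum (fun n : ℕ+ => (piltz k n : ℂ) * (n : ℂ) ^ (-s)) (riemannZeta s ^ k) := by
  have h : HasSum (LSeries.term (fun n => (piltz k n : ℂ)) s) (riemannZeta s ^ k) :=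
    lSeriesHasSum_piltz k hs
  rw [← Function.Injective.hasSum_iff PNat.coe_injective] at h
  · refine h.congr_fun fun n => ?_
    simp [cpow_neg, div_eq_mul_inv]
  · intro n hn
    have : n = 0 := by
      by_contra h0
      exact hn ⟨⟨n, Nat.pos_of_ne_zero h0⟩, rfl⟩
    simp [this]

lemma summable_piltz (k : ℕ) {c : ℝ} (hc : 1 < c) :
    Summable fun n : ℕ+ => (piltz k n : ℝ) * (n : ℝ) ^ (-c) := by
  have h := (hasSum_piltz k (s := c) (by simpa using hc)).summable.norm
  refine h.congr fun n => ?_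
  have hn : (0 : ℝ) < (n : ℝ) := by exact_mod_cast n.pos
  rw [norm_mul, ← ofReal_natCast (n : ℕ), norm_cpow_eq_rpow_re_of_pos hn]
  simp

/-! ### Interchanging summation and integration along a vertical line -/

lemma integrable_mul_cpow_line {φ : ℂ → ℂ} {c : ℝ} (hφ : Integrable fun t : ℝ => φ (c + t * I))
    {y : ℝ} (hy : 0 < y) :
    Integrable fun t : ℝ => φ (c + t * I) * (y : ℂ) ^ (-(c + t * I : ℂ)) := by
  have hy' : (y : ℂ) ≠ 0 := by exact_mod_cast hy.ne'
  refine hφ.mul_bdd (c := y ^ (-c)) (Continuous.aestronglyMeasurable ?_)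
    (Eventually.of_forall fun t => ?_)
  · exact Continuous.const_cpow (by fun_prop) (Or.inl hy')
  · rw [norm_cpow_eq_rpow_re_of_pos hy]
    simp

lemma norm_mul_cpow_line (z : ℂ) {y : ℝ} (hy : 0 < y) (c t : ℝ) :
    ‖z * (y : ℂ) ^ (-(c + t * I : ℂ))‖ = ‖z‖ * y ^ (-c) := by
  rw [norm_mul, norm_cpow_eq_rpow_re_of_pos hy]
  simp

/-- On the line `|n^(-w)| = n^(-c)` is constant, so the `L¹` norms of the terms are a fixed multiple
of `‖a n‖ n^(-c)`. It serves twice: for the sum over `j` inside `Ψ` and for the outer sum over `n`.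
-/
theorem hasSum_integral_line {φ : ℂ → ℂ} {c : ℝ} (hφ : Integrable fun t : ℝ => φ (c + t * I))
    {a : ℕ+ → ℂ} (ha : Summable fun n : ℕ+ => ‖a n‖ * (n : ℝ) ^ (-c)) {y : ℝ} (hy : 0 < y) :
    HasSum (fun n : ℕ+ => a n * ∫ t : ℝ, φ (c + t * I) * ((y * n : ℝ) : ℂ) ^ (-(c + t * I : ℂ)))
      (∫ t : ℝ, φ (c + t * I) * (y : ℂ) ^ (-(c + t * I : ℂ)) *
        ∑' n : ℕ+, a n * (n : ℂ) ^ (-(c + t * I : ℂ))) := by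
  have hn : ∀ n : ℕ+, (0 : ℝ) < (n : ℝ) := fun n => by exact_mod_cast n.pos
  have hyn : ∀ n : ℕ+, 0 < y * (n : ℝ) := fun n => mul_pos hy (hn n)
  have h := hasSum_integral_of_summable_integral_norm (μ := volume)
    (F := fun (n : ℕ+) (t : ℝ) =>
      a n * (φ (c + t * I) * ((y * n : ℝ) : ℂ) ^ (-(c + t * I : ℂ))))
    (fun n => (integrable_mul_cpow_line hφ (hyn n)).const_mul _) (by
      refine (ha.mul_left (y ^ (-c) * ∫ t : ℝ, ‖φ (c + t * I)‖)).congr fun n => ?_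
      simp_rw [norm_mul (a n), norm_mul_cpow_line _ (hyn n)]
      rw [integral_const_mul, integral_mul_const, Real.mul_rpow hy.le (hn n).le]
      ring)
  simp_rw [integral_const_mul] at h
  convert! h using 1
  congr 1
  funext t
  rw [← tsum_mul_left]
  refine tsum_congr fun n => ?_
  rw [ofReal_mul, mul_cpow_ofReal_nonneg hy.le (hn n).le, ofReal_natCast]
  ring

/-! ### The Meijer function and `Ψ` as inverse Mellin transforms -/

/-- The Mellin transform of `Ψ_{1,m+1}`, up to the factor `ζ ^ (m + 1)`. -/
noncomputable def psiKernel (m : ℕ) (w : ℂ) : ℂ := Gamma w ^ (m + 1) * cos (Real.pi * w / 2) ^ m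

/-- There is one more Gamma factor than cosines, so a net rate `-π/2` survives; `ε` is shared among
the `m + 1` Gamma factors. -/
lemma stripBound_psiKernel (m : ℕ) (a b : ℝ) {ε : ℝ} (hε : 0 < ε) :
    StripBound (psiKernel m) a b (-(Real.pi / 2) + ε) := by
  have hm : (0 : ℝ) < (m + 1 : ℕ) := by positivity
  refine (((stripBound_Gamma a b (div_pos hε hm)).pow (m + 1)).mul
    ((stripBound_cos a b).pow m)).mono le_rfl le_rfl (le_of_eq ?_)
  rw [mul_add, mul_div_cancel₀ _ hm.ne']
  push_cast
  ring

lemma differentiableAt_Gamma_of_re_pos {w : ℂ} (hw : 0 < w.re) : DifferentiableAt ℂ Gamma w :=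
  differentiableAt_Gamma w fun n h => by
    have h1 := congrArg Complex.re h
    simp only [neg_re, natCast_re] at h1
    linarith [n.cast_nonneg (α := ℝ)]

lemma differentiableAt_psiKernel (m : ℕ) {w : ℂ} (hw : DifferentiableAt ℂ Gamma w) :
    DifferentiableAt ℂ (psiKernel m) w := by
  unfold psiKernel
  exact (hw.fun_pow _).mul (by fun_prop)

lemma differentiableOn_psiKernel (m : ℕ) {a b : ℝ} (ha : 0 < a) :
    DifferentiableOn ℂ (psiKernel m) (strip a b) := fun _ hw =>
  (differentiableAt_psiKernel m
    (differentiableAt_Gamma_of_re_pos (ha.trans_le hw.1))).differentiableWithinAt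

lemma integrable_psiKernel (m : ℕ) {c : ℝ} (hc : 0 < c) :
    Integrable fun t : ℝ => psiKernel m (c + t * I) :=
  (stripBound_psiKernel m c c (ε := Real.pi / 4) (by positivity)).integrable
    (by linarith [Real.pi_pos]) le_rfl le_rfl
    (continuous_line_of_continuousOn (differentiableOn_psiKernel m hc (b := c)).continuousOn
      (line_mem_strip_left le_rfl))

/-- The integrand has no pole in `Re w > 0`. This is why the choice of `C < 0` is immaterial. -/
lemma integral_psiKernel_mul_cpow_eq (m : ℕ) {a b : ℝ} (ha : 0 < a) (hb : 0 < b) {y : ℝ}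
    (hy : 0 < y) :
    ∫ t : ℝ, psiKernel m (b + t * I) * (y : ℂ) ^ (-(b + t * I : ℂ)) =
      ∫ t : ℝ, psiKernel m (a + t * I) * (y : ℂ) ^ (-(a + t * I : ℂ)) := by
  wlog hab : a ≤ b generalizing a b
  · exact (this hb ha (le_of_not_ge hab)).symm
  have hbd : StripBound (fun w => psiKernel m w * (y : ℂ) ^ (-w)) a b (-(Real.pi / 4)) := by
    refine (((stripBound_psiKernel m a b (ε := Real.pi / 4) (by positivity)).mul
      (stripBound_cpow hy (-1) 0 a b)).mono le_rfl le_rfl (le_of_eq (by ring))).congr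
      fun s _ _ _ => ?_
    simp
  refine integral_line_eq (f := fun w => psiKernel m w * (y : ℂ) ^ (-w)) hab ?_
    (hbd.tendsto_zero (by linarith [Real.pi_pos]))
    (integrable_mul_cpow_line (integrable_psiKernel m ha) hy)
    (integrable_mul_cpow_line (integrable_psiKernel m hb) hy)
  exact (differentiableOn_psiKernel m ha).mul (fun w _ =>
    (differentiableAt_id.neg.const_cpow (Or.inl (by exact_mod_cast hy.ne'))).differentiableWithinAt)

lemma inv_Gamma_half_add {s : ℂ} (hs : s.re < 0) :
    (Gamma (1 / 2 + s))⁻¹ = Gamma (1 / 2 - s) * cos (Real.pi * s) / Real.pi := by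
  have hpi : (Real.pi : ℂ) ≠ 0 := by exact_mod_cast Real.pi_ne_zero
  have hprod := Gamma_mul_Gamma_one_sub (1 / 2 + s)
  rw [show (1 - (1 / 2 + s) : ℂ) = 1 / 2 - s by ring,
    show (Real.pi * (1 / 2 + s) : ℂ) = Real.pi * s + Real.pi / 2 by ring,
    Complex.sin_add_pi_div_two] at hprod
  have hne : Gamma (1 / 2 - s) ≠ 0 := Gamma_ne_zero_of_re_pos (by
    simp only [sub_re, one_div, inv_re, re_ofNat, normSq_ofNat]
    linarith)
  -- A zero of the cosine is a pole of `Γ(1/2 + s)`, where `Gamma` takes the value 0; both sides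
  -- then vanish.
  by_cases hcos : cos (Real.pi * s) = 0
  · rw [hcos, div_zero] at hprod
    rw [(mul_eq_zero.1 hprod).resolve_right hne, hcos]
    simp
  · have hG : Gamma (1 / 2 + s) ≠ 0 := fun h => by
      rw [h, zero_mul] at hprod
      exact div_ne_zero hpi hcos hprod.symm
    rw [eq_div_iff hcos] at hprod
    rw [eq_div_iff hpi, inv_mul_eq_iff_eq_mul₀ hG]
    linear_combination -hprod

lemma Gamma_neg_mul_Gamma_half_sub (s : ℂ) :
    Gamma (-s) * Gamma (1 / 2 - s) =
      Gamma (-2 * s) * (2 : ℂ) ^ (1 + 2 * s) * (Real.sqrt Real.pi : ℂ) := by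
  have h := Gamma_mul_Gamma_add_half (-s)
  rw [show (-s + 1 / 2 : ℂ) = 1 / 2 - s by ring, show (2 * -s : ℂ) = -2 * s by ring,
    show (1 - -2 * s : ℂ) = 1 + 2 * s by ring] at h
  exact h

/-- The normalizing constant of the Mellin–Barnes integral after the substitution `w = -2 s`. -/
noncomputable def meijerConst (m : ℕ) : ℂ :=
  2 ^ (m + 1) * (Real.sqrt Real.pi : ℂ) ^ (m + 1) / (Real.pi : ℂ) ^ m

lemma ofReal_pow_cpow {x : ℝ} (hx : 0 ≤ x) (n : ℕ) (s : ℂ) :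
    ((x ^ n : ℝ) : ℂ) ^ s = ((x : ℂ) ^ s) ^ n := by
  induction n with
  | zero => simp
  | succ n ih => rw [pow_succ, ofReal_mul, mul_cpow_ofReal_nonneg (by positivity) hx, ih, pow_succ]

lemma cpow_two_mul (z s : ℂ) : z ^ (2 * s) = (z ^ s) ^ 2 := by
  exact_mod_cast cpow_nat_mul z 2 s

/-- Reflection moves the `m` denominators `Γ(1/2 + s)` upstairs as `Γ(1/2 - s) cos(πs)/π`. There are
then `m + 1` pairs `Γ(-s)Γ(1/2 - s)`, each of which duplication turns into a multiple of `Γ(-2s)`.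
-/
lemma meijerIntegrand_eq (m : ℕ) {y : ℝ} (hy : 0 < y) {s : ℂ} (hs : s.re < 0) :
    meijerIntegrand [] [] (lowerFst (m + 1)) (lowerSnd (m + 1))
        ((y ^ 2 / 2 ^ (2 * (m + 1)) : ℝ) : ℂ) s =
      meijerConst m * (psiKernel m (-2 * s) * (y : ℂ) ^ (2 * s)) := by
  have h2 : (2 : ℂ) ^ (2 * s) ≠ 0 := by simp [cpow_eq_zero_iff]
  have hpi : (Real.pi : ℂ) ≠ 0 := by exact_mod_cast Real.pi_ne_zero
  -- The powers of 2 produced by duplication cancel the `2^(2k)` in the argument of the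
  -- `G`-function.
  have hz : ((y ^ 2 / 2 ^ (2 * (m + 1)) : ℝ) : ℂ) ^ s * ((2 : ℂ) ^ (2 * s)) ^ (m + 1) =
      (y : ℂ) ^ (2 * s) := by
    rw [cpow_two_mul, cpow_two_mul, ← pow_mul, ← ofReal_pow_cpow hy.le, ← ofReal_ofNat,
      ← ofReal_pow_cpow zero_le_two, ← mul_cpow_ofReal_nonneg (by positivity) (by positivity),
      ← ofReal_mul, div_mul_cancel₀ _ (by positivity)]
  have h1 : meijerIntegrand [] [] (lowerFst (m + 1)) (lowerSnd (m + 1))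
        ((y ^ 2 / 2 ^ (2 * (m + 1)) : ℝ) : ℂ) s =
      (Gamma (-s) * Gamma (1 / 2 - s)) ^ (m + 1) * (cos (Real.pi * s) / Real.pi) ^ m *
        ((y ^ 2 / 2 ^ (2 * (m + 1)) : ℝ) : ℂ) ^ s := by
    have hinv := inv_Gamma_half_add hs
    simp only [meijerIntegrand, lowerFst, lowerSnd, List.map_append, List.map_replicate,
      List.prod_append, List.prod_replicate, List.map_cons, List.map_nil, List.prod_cons,
      List.prod_nil, mul_one, Nat.add_sub_cancel, zero_sub]
    rw [show (1 - 1 / 2 + s : ℂ) = 1 / 2 + s by ring, div_eq_mul_inv _ (Gamma (1 / 2 + s) ^ m),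
      ← inv_pow, hinv]
    ring
  have hcos : cos (Real.pi * (-2 * s) / 2) = cos (Real.pi * s) := by
    rw [← cos_neg]
    ring_nf
  rw [h1, Gamma_neg_mul_Gamma_half_sub, cpow_add _ _ two_ne_zero, cpow_one, ← hz, psiKernel,
    hcos, meijerConst]
  simp only [mul_pow, div_pow]
  ring

lemma psiArg_eq (k : ℕ) (ρ x : ℝ) (j : ℕ) :
    psiArg k ρ x j = (ρ * x * j) ^ 2 / 2 ^ (2 * k) := by
  rw [psiArg]
  ring

lemma meijerIntegrand_line_eq (m : ℕ) {y : ℝ} (hy : 0 < y) {C : ℝ} (hC : C < 0) (t : ℝ) :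
    meijerIntegrand [] [] (lowerFst (m + 1)) (lowerSnd (m + 1))
        ((y ^ 2 / 2 ^ (2 * (m + 1)) : ℝ) : ℂ) (C + t * I) =
      meijerConst m * (psiKernel m ((-2 * C : ℝ) + (-2 * t : ℝ) * I) *
        (y : ℂ) ^ (-((-2 * C : ℝ) + (-2 * t : ℝ) * I : ℂ))) := by
  rw [meijerIntegrand_eq m hy (by simpa using hC)]
  push_cast
  ring_nf

lemma integrable_meijerIntegrand (m : ℕ) {y : ℝ} (hy : 0 < y) {C : ℝ} (hC : C < 0) :
    Integrable fun t : ℝ => meijerIntegrand [] [] (lowerFst (m + 1)) (lowerSnd (m + 1))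
        ((y ^ 2 / 2 ^ (2 * (m + 1)) : ℝ) : ℂ) (C + t * I) := by
  simp_rw [meijerIntegrand_line_eq m hy hC]
  have hc : 0 < -2 * C := by linarith
  exact ((integrable_mul_cpow_line (integrable_psiKernel m hc) hy).comp_mul_left'
    (R := -2) (by norm_num)).const_mul _

lemma meijerG_eq (m : ℕ) {y : ℝ} (hy : 0 < y) {C c : ℝ} (hC : C < 0) (hc : 0 < c) :
    meijerG C [] [] (lowerFst (m + 1)) (lowerSnd (m + 1))
        ((y ^ 2 / 2 ^ (2 * (m + 1)) : ℝ) : ℂ) =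
      1 / (2 * Real.pi) * (meijerConst m / 2 *
        ∫ t : ℝ, psiKernel m (c + t * I) * (y : ℂ) ^ (-(c + t * I : ℂ))) := by
  rw [meijerG]
  simp_rw [meijerIntegrand_line_eq m hy hC]
  rw [integral_const_mul, Measure.integral_comp_mul_left (fun u : ℝ =>
    psiKernel m ((-2 * C : ℝ) + u * I) * (y : ℂ) ^ (-((-2 * C : ℝ) + u * I : ℂ))) (-2),
    integral_psiKernel_mul_cpow_eq m hc (by linarith) hy]
  have : |(-2 : ℝ)⁻¹| = 1 / 2 := by norm_num
  rw [this, real_smul]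
  push_cast
  ring

lemma psiConst_mul_meijerConst (m : ℕ) :
    ((Real.pi ^ (((m + 1 : ℕ) : ℝ) / 2 - 1) / 2 ^ (m + 1 - 1) : ℝ) : ℂ) * (meijerConst m / 2) = 1 := by
  have hpi := Real.pi_pos
  have h : meijerConst m / 2 = ((2 ^ m * Real.pi ^ (1 - ((m + 1 : ℕ) : ℝ) / 2) : ℝ) : ℂ) := by
    have h1 : Real.pi ^ (1 - ((m + 1 : ℕ) : ℝ) / 2) = Real.sqrt Real.pi ^ (m + 1) / Real.pi ^ m := by
      rw [Real.sqrt_eq_rpow, ← Real.rpow_natCast, ← Real.rpow_natCast, ← Real.rpow_mul hpi.le,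
        ← Real.rpow_sub hpi]
      congr 1
      push_cast
      ring
    rw [meijerConst, h1]
    push_cast
    ring
  rw [h, ← ofReal_mul, ← ofReal_one]
  congr 1
  rw [Nat.add_sub_cancel, show (1 - ((m + 1 : ℕ) : ℝ) / 2) = -(((m + 1 : ℕ) : ℝ) / 2 - 1) by ring,
    Real.rpow_neg hpi.le]
  have := Real.rpow_pos_of_pos hpi (((m + 1 : ℕ) : ℝ) / 2 - 1)
  field_simp

lemma psiTerm_eq (m : ℕ) {ρ x C c : ℝ} (hρ : 0 < ρ) (hx : 0 < x) (hC : C < 0) (hc : 0 < c)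
    (j : ℕ+) :
    psiTerm C (m + 1) ρ x j = (1 / (2 * Real.pi) * (meijerConst m / 2)) * ((piltz (m + 1) j : ℂ) *
      ∫ t : ℝ, psiKernel m (c + t * I) * ((ρ * x * j : ℝ) : ℂ) ^ (-(c + t * I : ℂ))) := by
  have hj : (0 : ℝ) < (j : ℝ) := by exact_mod_cast j.pos
  rw [psiTerm, psiArg_eq, meijerG_eq m (by positivity) hC hc]
  ring

lemma hasSum_psiTerm (m : ℕ) {ρ x C c : ℝ} (hρ : 0 < ρ) (hx : 0 < x) (hC : C < 0) (hc : 1 < c) :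
    HasSum (fun j : ℕ+ => psiTerm C (m + 1) ρ x j) (1 / (2 * Real.pi) * (meijerConst m / 2) *
      ∫ t : ℝ, psiKernel m (c + t * I) * ((ρ * x : ℝ) : ℂ) ^ (-(c + t * I : ℂ)) *
        riemannZeta (c + t * I) ^ (m + 1)) := by
  have hc0 : 0 < c := by linarith
  have h := hasSum_integral_line (integrable_psiKernel m hc0)
    (a := fun j : ℕ+ => (piltz (m + 1) j : ℂ)) (by simpa using summable_piltz (m + 1) hc)
    (mul_pos hρ hx)
  have hz : ∀ t : ℝ, ∑' n : ℕ+, (piltz (m + 1) n : ℂ) * (n : ℂ) ^ (-(c + t * I : ℂ)) =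
      riemannZeta (c + t * I) ^ (m + 1) := fun t => (hasSum_piltz _ (by simpa using hc)).tsum_eq
  simp_rw [hz] at h
  refine (h.mul_left (1 / (2 * Real.pi) * (meijerConst m / 2))).congr_fun fun j => ?_
  exact psiTerm_eq m hρ hx hC hc0 j

theorem Psi_eq (m : ℕ) {ρ x C c : ℝ} (hρ : 0 < ρ) (hx : 0 < x) (hC : C < 0) (hc : 1 < c) :
    Psi C (m + 1) ρ x = 1 / (2 * Real.pi) *
      ∫ t : ℝ, psiKernel m (c + t * I) * riemannZeta (c + t * I) ^ (m + 1) *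
        ((ρ * x : ℝ) : ℂ) ^ (-(c + t * I : ℂ)) := by
  rw [Psi, (hasSum_psiTerm m hρ hx hC hc).tsum_eq]
  simp_rw [mul_right_comm _ (riemannZeta _ ^ (m + 1))]
  linear_combination (1 / (2 * (Real.pi : ℂ)) * ∫ t : ℝ, psiKernel m (c + t * I) *
    ((ρ * x : ℝ) : ℂ) ^ (-(c + t * I : ℂ)) * riemannZeta (c + t * I) ^ (m + 1)) *
    psiConst_mul_meijerConst m

lemma integrable_psiKernel_mul_zeta (m : ℕ) {c : ℝ} (hc : 1 < c) :
    Integrable fun t : ℝ => psiKernel m (c + t * I) * riemannZeta (c + t * I) ^ (m + 1) := by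
  have hm : (0 : ℝ) < (m + 1 : ℕ) := by positivity
  have hpi := Real.pi_pos
  refine StripBound.integrable (f := fun w => psiKernel m w * riemannZeta w ^ (m + 1))
    (((stripBound_psiKernel m c c (ε := Real.pi / 8) (by positivity)).mul
      ((stripBound_riemannZeta c c (div_pos (div_pos hpi (by norm_num : (0 : ℝ) < 8)) hm)).pow
        (m + 1)))) ?_ le_rfl le_rfl ?_
  · rw [mul_div_cancel₀ _ hm.ne']
    linarith
  · refine continuous_line_of_continuousOn (S := strip c c)
      (f := fun w => psiKernel m w * riemannZeta w ^ (m + 1)) (fun w hw => ?_)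
      (line_mem_strip_left le_rfl)
    have h1 : w ≠ 1 := by
      rintro rfl
      have := hw.1
      simp only [one_re] at this
      linarith
    exact ((differentiableAt_psiKernel m (differentiableAt_Gamma_of_re_pos
      (by linarith [hw.1]))).mul ((differentiableAt_riemannZeta h1).fun_pow
        _)).continuousAt.continuousWithinAt

/-- The series of the main identity as an inverse Mellin transform. -/
theorem hasSum_mul_piltz_mul_Psi (m : ℕ) {ρ C c : ℝ} (hρ : 0 < ρ) (hC : C < 0) (hc : 2 < c) :
    HasSum (fun n : ℕ+ => (n : ℂ) * (piltz (m + 1) n : ℂ) * Psi C (m + 1) ρ (n : ℝ))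
      (1 / (2 * Real.pi) * ∫ t : ℝ, psiKernel m (c + t * I) * riemannZeta (c + t * I) ^ (m + 1) *
        (ρ : ℂ) ^ (-(c + t * I : ℂ)) * riemannZeta (c + t * I - 1) ^ (m + 1)) := by
  have hpos : ∀ n : ℕ+, (0 : ℝ) < (n : ℝ) := fun n => by exact_mod_cast n.pos
  have h := hasSum_integral_line (integrable_psiKernel_mul_zeta m (by linarith : 1 < c))
    (φ := fun w => psiKernel m w * riemannZeta w ^ (m + 1))
    (a := fun n : ℕ+ => (n : ℂ) * (piltz (m + 1) n : ℂ)) (by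
      -- The weight `n` shifts the Dirichlet series to `w - 1`, hence the requirement `c > 2`.
      refine (summable_piltz (m + 1) (by linarith : 1 < c - 1)).congr fun n => ?_
      rw [norm_mul, norm_natCast, norm_natCast, neg_sub, sub_eq_add_neg,
        Real.rpow_add (hpos n), Real.rpow_one]
      ring) hρ
  have hz : ∀ t : ℝ, ∑' n : ℕ+, (n : ℂ) * (piltz (m + 1) n : ℂ) * (n : ℂ) ^ (-(c + t * I : ℂ)) =
      riemannZeta (c + t * I - 1) ^ (m + 1) := fun t => by
    rw [← (hasSum_piltz (m + 1) (s := c + t * I - 1)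
      (by simp; linarith)).tsum_eq]
    refine tsum_congr fun n => ?_
    have hn : ((n : ℕ) : ℂ) ≠ 0 := by exact_mod_cast n.ne_zero
    rw [show (-(c + t * I - 1) : ℂ) = 1 + -(c + t * I) by ring, cpow_add _ _ hn, cpow_one]
    ring
  simp_rw [hz] at h
  refine (h.mul_left (1 / (2 * (Real.pi : ℂ)))).congr_fun fun n => ?_
  rw [Psi_eq m hρ (hpos n) hC (by linarith : 1 < c)]
  ring

/-! ### The symmetric integrand and its residues -/

/-- The function `α ^ (-(m + 1) (s - 1)) + β ^ (-(m + 1) (s - 1))`. -/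
noncomputable def powSum (m : ℕ) (α β : ℝ) (s : ℂ) : ℂ :=
  (α : ℂ) ^ (-((m + 1 : ℕ) : ℂ) * (s - 1)) + (β : ℂ) ^ (-((m + 1 : ℕ) : ℂ) * (s - 1))

/-- The integrand whose residues give the right-hand side of the identity. -/
noncomputable def symIntegrand (m : ℕ) (α β : ℝ) (w : ℂ) : ℂ :=
  psiKernel m w * riemannZeta w ^ (m + 1) * riemannZeta (w - 1) ^ (m + 1) *
    (2 : ℂ) ^ (-((m + 1 : ℕ) : ℂ) * w) * powSum m α β w

/-- The numerator of `symIntegrand` at its pole at the origin. -/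
noncomputable def originNumerator (m : ℕ) (α β : ℝ) (s : ℂ) : ℂ :=
  riemannZeta (s - 1) ^ (m + 1) * riemannZeta s ^ (m + 1) * Gamma (s + 1) ^ (m + 1) *
    cos (Real.pi * s / 2) ^ m * (2 : ℂ) ^ (-((m + 1 : ℕ) : ℂ) * s) * powSum m α β s

/-- The base of the `(m + 1)`-st power in `symIntegrand`, in symmetric form. -/
noncomputable def zetaPair (w : ℂ) : ℂ :=
  riemannZeta (1 - w) * riemannZeta (w - 1) * (Real.pi : ℂ) ^ w / 2

lemma differentiable_powSum (m : ℕ) {α β : ℝ} (hα : 0 < α) (hβ : 0 < β) :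
    Differentiable ℂ (powSum m α β) := by
  have h : ∀ x : ℝ, 0 < x → Differentiable ℂ fun s : ℂ =>
      (x : ℂ) ^ (-((m + 1 : ℕ) : ℂ) * (s - 1)) := fun x hx =>
    Differentiable.const_cpow (by fun_prop) (Or.inl (by exact_mod_cast hx.ne'))
  exact (h α hα).add (h β hβ)

lemma differentiable_two_cpow (m : ℕ) :
    Differentiable ℂ fun s : ℂ => (2 : ℂ) ^ (-((m + 1 : ℕ) : ℂ) * s) :=
  Differentiable.const_cpow (by fun_prop) (Or.inl two_ne_zero)

lemma stripBound_powSum_term {x : ℝ} (hx : 0 < x) (m : ℕ) (a b : ℝ) :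
    StripBound (fun s => (x : ℂ) ^ (-((m + 1 : ℕ) : ℂ) * (s - 1))) a b 0 := by
  refine (stripBound_cpow hx (-(m + 1 : ℕ)) ((m + 1 : ℕ) : ℂ) a b).congr fun s _ _ _ => ?_
  congr 1
  push_cast
  ring

lemma StripBound.add {f g : ℂ → ℂ} {a b δ : ℝ} (hf : StripBound f a b δ)
    (hg : StripBound g a b δ) : StripBound (fun s => f s + g s) a b δ := by
  obtain ⟨K, hK, hf⟩ := hf
  obtain ⟨L, hL, hg⟩ := hg
  refine ⟨K + L, add_nonneg hK hL, fun s h1 h2 h3 => (norm_add_le _ _).trans ?_⟩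
  rw [add_mul]
  exact add_le_add (hf s h1 h2 h3) (hg s h1 h2 h3)

lemma stripBound_symIntegrand (m : ℕ) {α β : ℝ} (hα : 0 < α) (hβ : 0 < β) (a b : ℝ) :
    StripBound (symIntegrand m α β) a b (-(Real.pi / 4)) := by
  have hm : (0 : ℝ) < (m + 1 : ℕ) := by positivity
  -- The kernel and the two zeta powers may each lose `π/12`, and `-π/2 + 3π/12 = -π/4`.
  have hε : 0 < Real.pi / 12 / (m + 1 : ℕ) := by positivity
  have hz : StripBound (fun s => riemannZeta (s - 1)) a b (Real.pi / 12 / (m + 1 : ℕ)) := by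
    have h := (stripBound_riemannZeta (a - 1) (b - 1) hε).comp_add_const (-1)
    rw [sub_neg_eq_add, sub_neg_eq_add, sub_add_cancel, sub_add_cancel] at h
    refine h.congr fun s _ _ _ => ?_
    push_cast
    rfl
  have h2 : StripBound (fun s => (2 : ℂ) ^ (-((m + 1 : ℕ) : ℂ) * s)) a b 0 := by
    refine (stripBound_cpow two_pos (-(m + 1 : ℕ)) 0 a b).congr fun s _ _ _ => ?_
    push_cast
    rw [add_zero]
  refine (((((stripBound_psiKernel m a b (ε := Real.pi / 12) (by positivity)).mul
    ((stripBound_riemannZeta a b hε).pow (m + 1))).mul (hz.pow (m + 1))).mul h2).mul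
    ((stripBound_powSum_term hα m a b).add (stripBound_powSum_term hβ m a b))).mono
    le_rfl le_rfl (le_of_eq ?_)
  rw [mul_div_cancel₀ _ hm.ne']
  ring

lemma differentiableAt_symIntegrand (m : ℕ) {α β : ℝ} (hα : 0 < α) (hβ : 0 < β) {w : ℂ}
    (hw : ∀ n : ℤ, w ≠ n) : DifferentiableAt ℂ (symIntegrand m α β) w := by
  have h1 : w ≠ 1 := by simpa using hw 1
  have h2 : w - 1 ≠ 1 := fun h => by
    refine hw 2 ?_
    push_cast
    linear_combination h
  have hΓ : DifferentiableAt ℂ Gamma w :=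
    differentiableAt_Gamma w fun n h => hw (-n) (by push_cast; exact h)
  have hz2 : DifferentiableAt ℂ (fun s => riemannZeta (s - 1)) w :=
    (differentiableAt_riemannZeta h2).comp w (differentiableAt_id.sub_const 1)
  exact ((((differentiableAt_psiKernel m hΓ).mul
    ((differentiableAt_riemannZeta h1).fun_pow _)).mul (hz2.fun_pow _)).mul
    (differentiable_two_cpow m w)).mul (differentiable_powSum m hα hβ w)

lemma line_ne_int {c : ℝ} (hc : ∀ n : ℤ, c ≠ n) (t : ℝ) (n : ℤ) : (c + t * I : ℂ) ≠ n := fun h =>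
  hc n (by simpa using congrArg Complex.re h)

lemma integrable_symIntegrand (m : ℕ) {α β : ℝ} (hα : 0 < α) (hβ : 0 < β) {c : ℝ}
    (hc : ∀ n : ℤ, c ≠ n) : Integrable fun t : ℝ => symIntegrand m α β (c + t * I) :=
  (stripBound_symIntegrand m hα hβ c c).integrable (by linarith [Real.pi_pos]) le_rfl le_rfl
    (continuous_line_of_continuousOn (S := {w | ∀ n : ℤ, w ≠ n})
      (fun _ hw => (differentiableAt_symIntegrand m hα hβ hw).continuousAt.continuousWithinAt)
      (line_ne_int hc))

lemma cos_ne_zero_of_ne_int {w : ℂ} (hw : ∀ n : ℤ, w ≠ n) : cos (Real.pi * w / 2) ≠ 0 := by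
  rw [Complex.cos_ne_zero_iff]
  intro n h
  refine hw (2 * n + 1) ?_
  have hpi : (Real.pi : ℂ) ≠ 0 := by exact_mod_cast Real.pi_ne_zero
  have : (Real.pi : ℂ) * (w - (2 * n + 1)) = 0 := by linear_combination 2 * h
  rcases mul_eq_zero.1 this with h | h
  · exact absurd h hpi
  · push_cast
    linear_combination h

/-- The functional equation absorbs `Γ(w) cos(πw/2) ζ(w)` into `ζ(1-w)`. This uses `m + 1` cosines
where only `m` are present, which leaves one in the denominator. -/
lemma symIntegrand_eq (m : ℕ) (α β : ℝ) {w : ℂ} (hn : ∀ n : ℕ, w ≠ -n) (h1 : w ≠ 1)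
    (hcos : cos (Real.pi * w / 2) ≠ 0) :
    symIntegrand m α β w = zetaPair w ^ (m + 1) / cos (Real.pi * w / 2) * powSum m α β w := by
  have hpair : zetaPair w =
      Gamma w * cos (Real.pi * w / 2) * riemannZeta w * riemannZeta (w - 1) * (2 : ℂ) ^ (-w) := by
    have hpi : (Real.pi : ℂ) ^ w ≠ 0 := by simp [cpow_eq_zero_iff, Real.pi_ne_zero]
    rw [zetaPair, riemannZeta_one_sub hn h1, ← ofReal_ofNat 2,
      mul_cpow_ofReal_nonneg zero_le_two Real.pi_pos.le, cpow_neg (Real.pi : ℂ)]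
    field_simp
  have h2 : (2 : ℂ) ^ (-((m + 1 : ℕ) : ℂ) * w) = ((2 : ℂ) ^ (-w)) ^ (m + 1) := by
    rw [← cpow_nat_mul]
    ring_nf
  rw [symIntegrand, psiKernel, hpair, h2]
  field_simp
  ring

/-- With `u = k(w-1)`, the relation `α^u β^u = π^(2u)` exchanges `α^u` with `π^(2u) β^(-u)`, so the
reflection swaps the two summands. -/
lemma powSum_two_sub (m : ℕ) {α β : ℝ} (hα : 0 < α) (hβ : 0 < β) (hαβ : α * β = Real.pi ^ 2)
    (w : ℂ) : ((Real.pi : ℂ) ^ (2 - w)) ^ (m + 1) * powSum m α β (2 - w) =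
      ((Real.pi : ℂ) ^ w) ^ (m + 1) * powSum m α β w := by
  have hpi : (Real.pi : ℂ) ≠ 0 := by exact_mod_cast Real.pi_ne_zero
  set u : ℂ := ((m + 1 : ℕ) : ℂ) * (w - 1) with hu
  have hprod : (α : ℂ) ^ u * (β : ℂ) ^ u = ((Real.pi : ℂ) ^ u) ^ 2 := by
    rw [← mul_cpow_ofReal_nonneg hα.le hβ.le, ← ofReal_mul, hαβ, ofReal_pow_cpow Real.pi_pos.le]
  have h1 : ((Real.pi : ℂ) ^ (2 - w)) ^ (m + 1) * ((Real.pi : ℂ) ^ u) ^ 2 =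
      ((Real.pi : ℂ) ^ w) ^ (m + 1) := by
    rw [← cpow_nat_mul, ← cpow_nat_mul, ← cpow_nat_mul, ← cpow_add _ _ hpi]
    congr 1
    rw [hu]
    push_cast
    ring
  have hα' : (α : ℂ) ^ u ≠ 0 := by simp [cpow_eq_zero_iff, hα.ne']
  have hβ' : (β : ℂ) ^ u ≠ 0 := by simp [cpow_eq_zero_iff, hβ.ne']
  rw [powSum, powSum, show -((m + 1 : ℕ) : ℂ) * (2 - w - 1) = u by rw [hu]; ring,
    show -((m + 1 : ℕ) : ℂ) * (w - 1) = -u by rw [hu]; ring, cpow_neg, cpow_neg, ← h1, ← hprod]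
  field_simp
  ring

/-- The functional equation of the integrand. -/
lemma symIntegrand_two_sub (m : ℕ) {α β : ℝ} (hα : 0 < α) (hβ : 0 < β)
    (hαβ : α * β = Real.pi ^ 2) {w : ℂ} (hw : ∀ n : ℤ, w ≠ n) :
    symIntegrand m α β (2 - w) = -symIntegrand m α β w := by
  have hw' : ∀ n : ℤ, 2 - w ≠ n := fun n h => hw (2 - n) (by push_cast; linear_combination -h)
  have hc : cos (Real.pi * (2 - w) / 2) = -cos (Real.pi * w / 2) := by
    rw [show (Real.pi * (2 - w) / 2 : ℂ) = Real.pi - Real.pi * w / 2 by ring, cos_pi_sub]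
  rw [symIntegrand_eq m α β (fun n h => hw' (-n) (by push_cast; exact h)) (by simpa using hw' 1)
      (cos_ne_zero_of_ne_int hw'),
    symIntegrand_eq m α β (fun n h => hw (-n) (by push_cast; exact h)) (by simpa using hw 1)
      (cos_ne_zero_of_ne_int hw), hc, zetaPair, zetaPair,
    show (1 - (2 - w) : ℂ) = w - 1 by ring, show (2 - w - 1 : ℂ) = 1 - w by ring]
  have h := powSum_two_sub m hα hβ hαβ w
  simp only [mul_pow, div_pow]
  rw [div_neg, neg_mul]
  linear_combination -(riemannZeta (w - 1) ^ (m + 1) * riemannZeta (1 - w) ^ (m + 1) /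
    2 ^ (m + 1) / cos (Real.pi * w / 2)) * h

lemma integral_symIntegrand_two_sub (m : ℕ) {α β : ℝ} (hα : 0 < α) (hβ : 0 < β)
    (hαβ : α * β = Real.pi ^ 2) {c : ℝ} (hc : ∀ n : ℤ, c ≠ n) :
    ∫ t : ℝ, symIntegrand m α β ((2 - c : ℝ) + t * I) = -∫ t : ℝ, symIntegrand m α β (c + t * I) := by
  rw [← integral_neg, ← integral_neg_eq_self]
  congr 1
  funext t
  rw [← symIntegrand_two_sub m hα hβ hαβ (line_ne_int hc t)]
  congr 1
  push_cast
  ring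

/-- Only the Gamma factors are singular at 0; `Γ(w) = Γ(w+1)/w` isolates the singularity. -/
lemma symIntegrand_eq_originNumerator_div (m : ℕ) (α β : ℝ) {w : ℂ} (hw : w ≠ 0) :
    symIntegrand m α β w = originNumerator m α β w / (w - (0 : ℝ)) ^ (m + 1) := by
  rw [symIntegrand, originNumerator, psiKernel, Gamma_add_one w hw, ofReal_zero, sub_zero]
  field_simp
  ring

lemma differentiableOn_originNumerator (m : ℕ) {α β : ℝ} (hα : 0 < α) (hβ : 0 < β) :
    DifferentiableOn ℂ (originNumerator m α β) (strip (-1 / 2) (1 / 2)) := by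
  intro w hw
  have h1 : w ≠ 1 := by
    rintro rfl
    have := hw.2
    norm_num at this
  have h2 : w - 1 ≠ 1 := fun h => by
    have h' := congrArg Complex.re h
    simp only [sub_re, one_re] at h'
    linarith [hw.2]
  have hΓ : DifferentiableAt ℂ (fun s => Gamma (s + 1)) w := by
    refine (differentiableAt_Gamma_of_re_pos ?_).comp w (differentiableAt_id.add_const 1)
    simp only [add_re, one_re]
    linarith [hw.1]
  have hz2 : DifferentiableAt ℂ (fun s => riemannZeta (s - 1)) w :=
    (differentiableAt_riemannZeta h2).comp w (differentiableAt_id.sub_const 1)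
  have hcos : DifferentiableAt ℂ (fun s : ℂ => cos (Real.pi * s / 2)) w := by fun_prop
  exact ((((((hz2.fun_pow _).mul ((differentiableAt_riemannZeta h1).fun_pow _)).mul
    (hΓ.fun_pow _)).mul (hcos.fun_pow _)).mul (differentiable_two_cpow m w)).mul
    (differentiable_powSum m hα hβ w)).differentiableWithinAt

lemma half_int_ne_int {n : ℤ} {c : ℝ} (hc : c = n + 1 / 2) (k : ℤ) : c ≠ k := fun h => by
  have h1 : ((2 * k : ℤ) : ℝ) = ((2 * n + 1 : ℤ) : ℝ) := by
    push_cast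
    linarith
  have h2 := Int.cast_injective h1
  omega

lemma stripVanish_symIntegrand (m : ℕ) {α β : ℝ} (hα : 0 < α) (hβ : 0 < β) (a b : ℝ) :
    StripVanish (symIntegrand m α β) a b :=
  (stripBound_symIntegrand m hα hβ a b).tendsto_zero (by linarith [Real.pi_pos])

lemma integral_symIntegrand_sub_origin (m : ℕ) {α β : ℝ} (hα : 0 < α) (hβ : 0 < β) :
    (∫ t : ℝ, symIntegrand m α β ((1 / 2 : ℝ) + t * I)) -
        ∫ t : ℝ, symIntegrand m α β ((-1 / 2 : ℝ) + t * I) =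
      2 * Real.pi * (iteratedDeriv m (originNumerator m α β) 0 / m.factorial) := by
  have h := integral_line_sub_eq (f := symIntegrand m α β) (g := originNumerator m α β)
    (a := -1 / 2) (b := 1 / 2) (p := 0) (by norm_num) (by norm_num) m
    (differentiableOn_originNumerator m hα hβ)
    (fun s _ hs => symIntegrand_eq_originNumerator_div m α β (by simpa using hs))
    (stripVanish_symIntegrand m hα hβ _ _)
    (integrable_symIntegrand m hα hβ (half_int_ne_int (n := -1) (by norm_num)))
    (integrable_symIntegrand m hα hβ (half_int_ne_int (n := 0) (by norm_num)))
  rw [h, ofReal_zero]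

lemma hasDerivAt_cos_pi_mul_half :
    HasDerivAt (fun s : ℂ => cos (Real.pi * s / 2)) (-(Real.pi / 2)) 1 := by
  have h : HasDerivAt (fun s : ℂ => (Real.pi * s / 2 : ℂ)) (Real.pi * 1 / 2) 1 :=
    ((hasDerivAt_id (1 : ℂ)).const_mul (Real.pi : ℂ)).div_const 2
  have h2 := h.ccos
  simpa using h2

/-- In the `zetaPair` form the only singular factor at 1 is `1/cos(πw/2)`, so the pole is simple.
The residue is `(π/8)^(m+1) · 2 / (-π/2)`, using `ζ(0) = -1/2`. -/
lemma integral_symIntegrand_sub_one (m : ℕ) {α β : ℝ} (hα : 0 < α) (hβ : 0 < β) :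
    (∫ t : ℝ, symIntegrand m α β ((3 / 2 : ℝ) + t * I)) -
        ∫ t : ℝ, symIntegrand m α β ((1 / 2 : ℝ) + t * I) =
      2 * Real.pi * (-2 * ((Real.pi : ℂ) / 2) ^ m * ((2 : ℂ) ^ (2 * (m + 1)))⁻¹) := by
  have hpi : (Real.pi : ℂ) ≠ 0 := by exact_mod_cast Real.pi_ne_zero
  set C : ℂ → ℂ := fun s => cos (Real.pi * s / 2) with hC
  set q : ℂ → ℂ := dslope C 1 with hq
  have hC1 : C 1 = 0 := by simp [hC]
  have hq1 : q 1 = -(Real.pi / 2) := by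
    rw [hq, dslope_same]
    exact hasDerivAt_cos_pi_mul_half.deriv
  have hqne : ∀ s : ℂ, s ≠ 1 → C s = (s - 1) * q s := fun s hs => by
    rw [hq, dslope_of_ne _ hs, slope_def_field, hC1, sub_zero,
      mul_div_cancel₀ _ (sub_ne_zero.2 hs)]
  have hint : ∀ s ∈ strip (1 / 2) (3 / 2), s ≠ 1 → ∀ n : ℤ, s ≠ n := fun s hs h1 n h => by
    have hre : s.re = n := by simpa using congrArg Complex.re h
    have h3 : (0 : ℝ) < n := by linarith [hs.1]
    have h4 : (n : ℝ) < 2 := by linarith [hs.2]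
    have h5 : (0 : ℤ) < n := by exact_mod_cast h3
    have h6 : n < 2 := by exact_mod_cast h4
    obtain rfl : n = 1 := by omega
    exact h1 (by simpa using h)
  -- `q` is the cosine with its zero at 1 divided out; the strip contains no other zero.
  have hq0 : ∀ s ∈ strip (1 / 2) (3 / 2), q s ≠ 0 := fun s hs h => by
    by_cases h1 : s = 1
    · rw [h1, hq1] at h
      simp [hpi] at h
    · refine cos_ne_zero_of_ne_int (hint s hs h1) ?_
      have := hqne s h1
      rwa [h, mul_zero] at this
  have hnhds : strip (1 / 2) (3 / 2) ∈ 𝓝 (1 : ℂ) :=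
    strip_mem_nhds (by norm_num) (by norm_num)
  have hCd : Differentiable ℂ C := by
    rw [hC]
    fun_prop
  have hqd : DifferentiableOn ℂ q (strip (1 / 2) (3 / 2)) :=
    (differentiableOn_dslope hnhds).2 hCd.differentiableOn
  have hpair : DifferentiableOn ℂ zetaPair (strip (1 / 2) (3 / 2)) := fun s hs => by
    have h1 : 1 - s ≠ 1 := fun h => by
      have h' := congrArg Complex.re h
      simp only [sub_re, one_re] at h'
      linarith [hs.1]
    have h2 : s - 1 ≠ 1 := fun h => by
      have h' := congrArg Complex.re h
      simp only [sub_re, one_re] at h'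
      linarith [hs.2]
    have hz1 : DifferentiableAt ℂ (fun s => riemannZeta (1 - s)) s :=
      (differentiableAt_riemannZeta h1).comp s (differentiableAt_id.const_sub 1)
    have hz2 : DifferentiableAt ℂ (fun s => riemannZeta (s - 1)) s :=
      (differentiableAt_riemannZeta h2).comp s (differentiableAt_id.sub_const 1)
    have hp : DifferentiableAt ℂ (fun s : ℂ => (Real.pi : ℂ) ^ s) s :=
      differentiableAt_id.const_cpow (Or.inl hpi)
    exact (((hz1.mul hz2).mul hp).div_const 2).differentiableWithinAt
  have h := integral_line_sub_eq (f := symIntegrand m α β)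
    (g := fun s => zetaPair s ^ (m + 1) / q s * powSum m α β s)
    (a := 1 / 2) (b := 3 / 2) (p := 1) (by norm_num) (by norm_num) 0
    (((hpair.fun_pow _).div hqd hq0).mul (differentiable_powSum m hα hβ).differentiableOn)
    (fun s hs h1 => by
      rw [ofReal_one] at h1
      have hn := hint s hs h1
      rw [symIntegrand_eq m α β (fun n h => hn (-n) (by push_cast; exact h)) h1
        (cos_ne_zero_of_ne_int hn)]
      have hcs : cos (Real.pi * s / 2) = (s - 1) * q s := hqne s h1
      have := hq0 s hs
      have := sub_ne_zero.2 h1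
      rw [hcs, ofReal_one, zero_add, pow_one]
      field_simp)
    (stripVanish_symIntegrand m hα hβ _ _)
    (integrable_symIntegrand m hα hβ (half_int_ne_int (n := 0) (by norm_num)))
    (integrable_symIntegrand m hα hβ (half_int_ne_int (n := 1) (by norm_num)))
  rw [h]
  have hp1 : zetaPair 1 = Real.pi / 2 / 4 := by
    simp only [zetaPair, sub_self, riemannZeta_zero, cpow_one]
    ring
  have hs1 : powSum m α β 1 = 2 := by
    simp only [powSum, sub_self, mul_zero, cpow_zero]
    norm_num
  have h4 : (2 : ℂ) ^ (2 * (m + 1)) = 4 ^ (m + 1) := by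
    rw [pow_mul]
    norm_num
  rw [iteratedDeriv_zero, ofReal_one, Nat.factorial_zero, Nat.cast_one, div_one, hp1, hs1, hq1, h4,
    div_pow, pow_succ (Real.pi / 2 : ℂ)]
  field_simp

theorem integral_symIntegrand (m : ℕ) {α β : ℝ} (hα : 0 < α) (hβ : 0 < β)
    (hαβ : α * β = Real.pi ^ 2) :
    1 / (2 * Real.pi) * ∫ t : ℝ, symIntegrand m α β ((5 / 2 : ℝ) + t * I) =
      1 / m.factorial * iteratedDeriv m (originNumerator m α β) 0 -
        ((Real.pi : ℂ) / 2) ^ m * ((2 : ℂ) ^ (2 * (m + 1)))⁻¹ := by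
  have hpi : (Real.pi : ℂ) ≠ 0 := by exact_mod_cast Real.pi_ne_zero
  have h1 := integral_symIntegrand_two_sub m hα hβ hαβ (c := 5 / 2)
    (half_int_ne_int (n := 2) (by norm_num))
  have h2 := integral_symIntegrand_two_sub m hα hβ hαβ (c := 3 / 2)
    (half_int_ne_int (n := 1) (by norm_num))
  rw [show (2 - 5 / 2 : ℝ) = -1 / 2 by norm_num] at h1
  rw [show (2 - 3 / 2 : ℝ) = 1 / 2 by norm_num] at h2
  have h3 := integral_symIntegrand_sub_origin m hα hβ
  have h4 := integral_symIntegrand_sub_one m hα hβ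
  rw [one_div, inv_mul_eq_iff_eq_mul₀ (by simp)]
  -- Oddness at `3/2` and the jump across 1 determine the integral over `Re w = 1/2` as `-πR₁`; this
  -- is where the half residue comes from.
  linear_combination h1 + h3 + h4 / 2 - h2 / 2

/-! ### The main identity -/

/-- This explains the choice `ρ = (2α)^k` and the prefactor `α^k`: together they produce one summand
of `powSum`. -/
lemma pow_mul_cpow_line (m : ℕ) {α : ℝ} (hα : 0 < α) (w : ℂ) :
    (α : ℂ) ^ (m + 1) * (((2 * α) ^ (m + 1) : ℝ) : ℂ) ^ (-w) =
      (2 : ℂ) ^ (-((m + 1 : ℕ) : ℂ) * w) * (α : ℂ) ^ (-((m + 1 : ℕ) : ℂ) * (w - 1)) := by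
  have hα' : (α : ℂ) ≠ 0 := by exact_mod_cast hα.ne'
  rw [ofReal_pow_cpow (by positivity), ofReal_mul, mul_cpow_ofReal_nonneg zero_le_two hα.le,
    ofReal_ofNat, mul_pow, ← cpow_nat_mul, ← cpow_nat_mul, ← cpow_natCast (α : ℂ) (m + 1),
    show -((m + 1 : ℕ) : ℂ) * (w - 1) = ((m + 1 : ℕ) : ℂ) + ((m + 1 : ℕ) : ℂ) * -w by ring,
    cpow_add _ _ hα', show -((m + 1 : ℕ) : ℂ) * w = ((m + 1 : ℕ) : ℂ) * -w by ring]
  ring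

lemma integrable_series_integrand (m : ℕ) {ρ c : ℝ} (hρ : 0 < ρ) (hc : 2 < c) :
    Integrable fun t : ℝ => psiKernel m (c + t * I) * riemannZeta (c + t * I) ^ (m + 1) *
        (ρ : ℂ) ^ (-(c + t * I : ℂ)) * riemannZeta (c + t * I - 1) ^ (m + 1) := by
  have hre : ∀ t : ℝ, 1 < (c + t * I - 1 : ℂ).re := fun t => by
    simp only [sub_re, add_re, ofReal_re, mul_re, I_re, mul_zero, ofReal_im, I_im, mul_one,
      sub_self, add_zero, one_re]
    linarith
  refine (integrable_mul_cpow_line (φ := fun w => psiKernel m w * riemannZeta w ^ (m + 1))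
    (integrable_psiKernel_mul_zeta m (by linarith)) hρ).mul_bdd
    (c := ∑' n : ℕ+, (piltz (m + 1) n : ℝ) * (n : ℝ) ^ (-(c - 1)))
    (Continuous.aestronglyMeasurable ?_) (Eventually.of_forall fun t => ?_)
  · refine Continuous.pow (continuous_line_of_continuousOn (f := fun w => riemannZeta (w - 1))
      (S := {w | w - 1 ≠ 1}) (fun w hw => ?_) fun t h => ?_) _
    · exact ((differentiableAt_riemannZeta hw).continuousAt.comp (f := fun w => w - 1)
        (by fun_prop)).continuousWithinAt
    · exact absurd (congrArg Complex.re h) (hre t).ne'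
  · rw [← (hasSum_piltz (m + 1) (hre t)).tsum_eq]
    refine tsum_of_norm_bounded (summable_piltz (m + 1) (by linarith : 1 < c - 1)).hasSum
      fun n => ?_
    have hn : (0 : ℝ) < (n : ℝ) := by exact_mod_cast n.pos
    rw [norm_mul, norm_natCast, ← ofReal_natCast (n : ℕ), norm_cpow_eq_rpow_re_of_pos hn]
    simp

theorem series_add_series (m : ℕ) {C : ℝ} (hC : C < 0) {α β : ℝ} (hα : 0 < α) (hβ : 0 < β) :
    (α : ℂ) ^ (m + 1) * (∑' n : ℕ+,
        (n : ℂ) * (piltz (m + 1) n : ℂ) * Psi C (m + 1) ((2 * α) ^ (m + 1)) (n : ℝ)) +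
      (β : ℂ) ^ (m + 1) * (∑' n : ℕ+,
        (n : ℂ) * (piltz (m + 1) n : ℂ) * Psi C (m + 1) ((2 * β) ^ (m + 1)) (n : ℝ)) =
    1 / (2 * Real.pi) * ∫ t : ℝ, symIntegrand m α β ((5 / 2 : ℝ) + t * I) := by
  have hα2 : (0 : ℝ) < (2 * α) ^ (m + 1) := by positivity
  have hβ2 : (0 : ℝ) < (2 * β) ^ (m + 1) := by positivity
  have hc : (2 : ℝ) < 5 / 2 := by norm_num
  rw [(hasSum_mul_piltz_mul_Psi m hα2 hC hc).tsum_eq,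
    (hasSum_mul_piltz_mul_Psi m hβ2 hC hc).tsum_eq, mul_left_comm, mul_left_comm _ (1 / (2 * _ : ℂ)),
    ← mul_add, ← integral_const_mul, ← integral_const_mul,
    ← integral_add ((integrable_series_integrand m hα2 hc).const_mul _)
      ((integrable_series_integrand m hβ2 hc).const_mul _)]
  congr 2
  funext t
  have h1 := pow_mul_cpow_line m hα ((5 / 2 : ℝ) + t * I)
  have h2 := pow_mul_cpow_line m hβ ((5 / 2 : ℝ) + t * I)
  rw [symIntegrand, powSum]
  generalize ((5 / 2 : ℝ) + t * I : ℂ) = w at *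
  linear_combination psiKernel m w * riemannZeta w ^ (m + 1) * riemannZeta (w - 1) ^ (m + 1) *
    (h1 + h2)

end ZetaPower

theorem corollary1p5 (k : ℕ) (hk : 1 ≤ k) (C : ℝ) (hC : C < 0)
    (α β : ℝ) (hα : 0 < α) (hβ : 0 < β) (hαβ : α * β = Real.pi ^ 2) :
    -- the functions `Ψ_{ρ,k}` are well defined: integrals and series converge absolutely
    (∀ ρ x : ℝ, 0 < ρ → 0 < x →
      (∀ j : ℕ+, MeasureTheory.Integrable (fun t : ℝ =>
        ZetaPower.meijerIntegrand [] [] (ZetaPower.lowerFst k) (ZetaPower.lowerSnd k)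
          (ZetaPower.psiArg k ρ x j) (C + t * Complex.I))) ∧
      Summable (fun j : ℕ+ => ZetaPower.psiTerm C k ρ x j)) ∧
    -- both series of the identity converge absolutely
    Summable (fun n : ℕ+ =>
      (n : ℂ) * (ZetaPower.piltz k n : ℂ) * ZetaPower.Psi C k ((2 * α) ^ k) (n : ℝ)) ∧
    Summable (fun n : ℕ+ =>
      (n : ℂ) * (ZetaPower.piltz k n : ℂ) * ZetaPower.Psi C k ((2 * β) ^ k) (n : ℝ)) ∧
    (α : ℂ) ^ k * (∑' n : ℕ+,
        (n : ℂ) * (ZetaPower.piltz k n : ℂ) * ZetaPower.Psi C k ((2 * α) ^ k) (n : ℝ)) +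
      (β : ℂ) ^ k * (∑' n : ℕ+,
        (n : ℂ) * (ZetaPower.piltz k n : ℂ) * ZetaPower.Psi C k ((2 * β) ^ k) (n : ℝ)) =
    1 / ((k - 1).factorial : ℂ) *
      iteratedDeriv (k - 1) (fun s : ℂ =>
        riemannZeta (s - 1) ^ k * riemannZeta s ^ k * Complex.Gamma (s + 1) ^ k *
          Complex.cos (Real.pi * s / 2) ^ (k - 1) * (2 : ℂ) ^ (-(k : ℂ) * s) *
          ((α : ℂ) ^ (-(k : ℂ) * (s - 1)) + (β : ℂ) ^ (-(k : ℂ) * (s - 1)))) 0 -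
      ((Real.pi : ℂ) / 2) ^ (k - 1) * ((2 : ℂ) ^ (2 * k))⁻¹ := by
  -- With `k = m + 1` the exponents `k - 1` become `m`, free of truncated subtraction.
  obtain ⟨m, rfl⟩ : ∃ m, k = m + 1 := ⟨k - 1, by omega⟩
  have hα2 : (0 : ℝ) < (2 * α) ^ (m + 1) := by positivity
  have hβ2 : (0 : ℝ) < (2 * β) ^ (m + 1) := by positivity
  have hc : (2 : ℝ) < 5 / 2 := by norm_num
  refine ⟨fun ρ x hρ hx => ⟨fun j => ?_, ?_⟩, ?_, ?_, ?_⟩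
  · have hj : (0 : ℝ) < (j : ℝ) := by exact_mod_cast j.pos
    rw [ZetaPower.psiArg_eq]
    exact ZetaPower.integrable_meijerIntegrand m (by positivity) hC
  · exact (ZetaPower.hasSum_psiTerm m hρ hx hC one_lt_two).summable
  · exact (ZetaPower.hasSum_mul_piltz_mul_Psi m hα2 hC hc).summable
  · exact (ZetaPower.hasSum_mul_piltz_mul_Psi m hβ2 hC hc).summable
  · rw [ZetaPower.series_add_series m hC hα hβ, ZetaPower.integral_symIntegrand m hα hβ hαβ,
      Nat.add_sub_cancel]
    rfl
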